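/- Let $0<\alpha<1$, let $\lambda\in\mathbb{C}\setminus\{0\}$ satisfy $|\arg\lambda|<\frac{\alpha\pi}{2}$ (with $-\pi<\arg\lambda\le\pi$), let $d\ge 1$, and let $A_\lambda\in\mathbb{C}^{d\times d}$ be the Jordan block with $\lambda$ on the diagonal, $1$ on the first superdiagonal and $0$ elsewhere. Let $g:[0,\infty)\to\mathbb{C}^d$ be bounded and continuous (in particular, $g$ may take values in $\mathbb{R}^d$). A solution of $$ {}^{C}D^{\alpha}_{0+}x(t)=A_\lambda x(t)+g(t) \qquad (\ast)$$ is a continuous function $x:[0,\infty)\to\mathbb{C}^d$ such that, for every $t>0$, the Caputo derivative $$ {}^{C}D^{\alpha}_{0+}x(t)=\frac{d}{dt}\,\frac{1}{\Gamma(1-\alpha)}\int_0^t (t-\tau)^{-\alpha}\bigl(x(\tau)-x(0)\bigr)\,d\tau $$ (taken componentwise) exists and $(\ast)$ holds at $t$. Then $(\ast)$ has exactly one solution that is bounded on $[0,\infty)$. If, in addition, $g(t)\to 0$ as $t\to\infty$, then this bounded solution tends to $0$ as $t\to\infty$. -/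

import Mathlib

open scoped NNReal BoundedContinuousFunction

noncomputable section

namespace CaputoJordan

/-- The open sector `Λ_α^u` of nonzero complex numbers with `|arg z| < α π / 2`, where the
argument is taken in `(-π, π]`. -/
def unstableSector (α : ℝ) : Set ℂ :=
  {z : ℂ | z ≠ 0 ∧ |Complex.arg z| < α * Real.pi / 2}

/-- The Riemann--Liouville fractional integral of order `β > 0` with lower terminal `a`. -/
def rlIntegral (β a : ℝ) (x : ℝ → ℂ) (t : ℝ) : ℂ :=
  ((1 / Real.Gamma β : ℝ) : ℂ) * ∫ τ in a..t, (((t - τ) ^ (β - 1) : ℝ) : ℂ) * x τ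

/-- `x` has Caputo derivative `v` of order `α ∈ (0, 1)`, with lower terminal `a`, at the point
`t > a`. This is the usual form of the Caputo derivative for functions that are merely
continuous: the Riemann--Liouville derivative `d/dt I_{a+}^{1-α}` applied to `x - x a`; it equals
`I_{a+}^{1-α} x'` when `x` is continuously differentiable. -/
def HasCaputoDerivAt (α a : ℝ) (x : ℝ → ℂ) (v : ℂ) (t : ℝ) : Prop :=
  HasDerivAt (rlIntegral (1 - α) a (fun τ => x τ - x a)) v t

/-- The upper triangular `d × d` Jordan block with eigenvalue `z`. -/
def jordanBlock (d : ℕ) (z : ℂ) : Matrix (Fin d) (Fin d) ℂ :=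
  Matrix.of fun i j => if i = j then z else if (i : ℕ) + 1 = (j : ℕ) then 1 else 0

/-- `x : [0, ∞) → ℂ^d` is a solution of `D^α x(t) = A x(t) + g(t)`, where `D^α` is the Caputo
derivative with lower terminal `0`, taken componentwise: `x` is continuous on `[0, ∞)`, and the
derivative exists and the equation holds at every `t > 0`. -/
structure IsSolution {d : ℕ} (α : ℝ) (A : Matrix (Fin d) (Fin d) ℂ) (g x : ℝ≥0 → Fin d → ℂ) :
    Prop where
  continuous : Continuous x
  hasCaputoDerivAt : ∀ t : ℝ≥0, 0 < t → ∀ i : Fin d,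
    HasCaputoDerivAt α 0 (fun s : ℝ => x s.toNNReal i) ((A.mulVec (x t) + g t) i) (t : ℝ)

/-- A solution that is bounded on `[0, ∞)`. -/
def IsBoundedSolution {d : ℕ} (α : ℝ) (A : Matrix (Fin d) (Fin d) ℂ) (g x : ℝ≥0 → Fin d → ℂ) :
    Prop :=
  IsSolution α A g x ∧ Bornology.IsBounded (Set.range x)

end CaputoJordan

end

open MeasureTheory Filter Topology

noncomputable section

namespace CaputoJordan

/-! Write the eigenvalue as `λ = exp (α w₁)` with `|Im w₁| < π/2`, and set `μ = exp w₁`, so that `μ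
^ α = λ` and `Re μ > 0`. For bounded continuous functions the scalar equation is equivalent to `s ^
α (X̂ - X(0)/s) = λ X̂ + Ĝ`. The factor `s ^ α - λ` vanishes only at `s = μ`, inside the half plane
where `X̂` converges, so boundedness forces the value of `X(0)`. For `G = 0` this gives `X(0) = 0`,
then `X̂ = 0`, and Fourier inversion gives `X = 0` (`eq_zero_of_hasCaputoDerivAt`).

For existence, split off the pole: `1/(s ^ α - λ) = ĥ(s) + c/(s - μ)` with `c = μ/(αλ)` and `h`
integrable (`exists_stable_kernel`). The kernel `h` is a superposition of decaying exponentials,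
weighted by the jump of `1/(s ^ α - λ)` across the negative axis. The formula is a keyhole Cauchy
integral, carried out in the variable `w = log s` on the strip `|Im w| ≤ π` (`integral_jump`).

With `γ = μ Ĝ(μ)` and `f = G - γ`, the transform of `f` vanishes at `μ`. The growing convolution
`exp(μ t) * f` therefore equals minus a convolution with an integrable kernel on the negative axis
(`conv_exp_causal_eq_neg`), and `X = -γ/λ + h * f + c exp(μ t) * f` is a bounded solution
(`exists_bounded_solution`). If `G → 0`, then `f → -γ`, and the value of `∫ h` makes the three
limits cancel.

A Jordan block is solved from its last row upwards: row `i` is a scalar equation with forcing `g i +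
x (i + 1)`, which is again bounded and continuous, and tends to zero if `g` does. -/

/-! ### Laplace transform and convolution of causal functions. -/

/-- The bilateral Laplace transform. -/
def lap (f : ℝ → ℂ) (s : ℂ) : ℂ := ∫ t : ℝ, Complex.exp (-s * t) * f t

/-- Convolution on the real line. -/
def conv (k f : ℝ → ℂ) (t : ℝ) : ℂ := ∫ τ : ℝ, k τ * f (t - τ)

/-- The restriction of a function to `(0, ∞)`, extended by zero. -/
def causal (f : ℝ → ℂ) : ℝ → ℂ := (Set.Ioi (0 : ℝ)).indicator f

lemma causal_of_pos (f : ℝ → ℂ) {t : ℝ} (ht : 0 < t) : causal f t = f t :=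
  Set.indicator_of_mem (Set.mem_Ioi.2 ht) f

lemma causal_of_nonpos (f : ℝ → ℂ) {t : ℝ} (ht : t ≤ 0) : causal f t = 0 :=
  Set.indicator_of_notMem (by simpa using ht) f

lemma continuousAt_causal {f : ℝ → ℂ} (hf : Continuous f) {t : ℝ} (ht : t ≠ 0) :
    ContinuousAt (causal f) t := by
  rcases lt_or_gt_of_ne ht with h | h
  · have : causal f =ᶠ[𝓝 t] fun _ => 0 := by
      filter_upwards [Iio_mem_nhds h] with s hs using causal_of_nonpos f (le_of_lt hs)
    exact continuousAt_const.congr this.symm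
  · have : causal f =ᶠ[𝓝 t] f := by
      filter_upwards [Ioi_mem_nhds h] with s hs using causal_of_pos f hs
    exact hf.continuousAt.congr this.symm

lemma norm_causal_le {f : ℝ → ℂ} {C : ℝ} (hC : 0 ≤ C) (hf : ∀ t, ‖f t‖ ≤ C) (t : ℝ) :
    ‖causal f t‖ ≤ C := by
  rcases le_or_gt t 0 with h | h
  · simpa [causal_of_nonpos f h] using hC
  · simpa [causal_of_pos f h] using hf t

lemma causal_sub (f g : ℝ → ℂ) (t : ℝ) : causal (fun t => f t - g t) t = causal f t - causal g t := by
  rcases le_or_gt t 0 with h | h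
  · simp [causal_of_nonpos, h]
  · simp [causal_of_pos, h]

lemma causal_add (f g : ℝ → ℂ) (t : ℝ) : causal (fun t => f t + g t) t = causal f t + causal g t := by
  rcases le_or_gt t 0 with h | h
  · simp [causal_of_nonpos, h]
  · simp [causal_of_pos, h]

lemma causal_const_mul (c : ℂ) (f : ℝ → ℂ) (t : ℝ) : causal (fun t => c * f t) t = c * causal f t := by
  rcases le_or_gt t 0 with h | h
  · simp [causal_of_nonpos, h]
  · simp [causal_of_pos, h]

lemma measurable_causal {f : ℝ → ℂ} (hf : Measurable f) : Measurable (causal f) :=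
  hf.indicator measurableSet_Ioi

lemma integrable_exp_mul_causal {s : ℂ} (hs : 0 < s.re) {f : ℝ → ℂ} (hf : Measurable f) {C : ℝ}
    (hC : ∀ t, ‖f t‖ ≤ C) : Integrable fun t : ℝ => Complex.exp (-s * t) * causal f t := by
  have h : IntegrableOn (fun t : ℝ => Complex.exp (-s * t)) (Set.Ioi 0) :=
    integrableOn_exp_mul_complex_Ioi (by simpa using hs) 0
  have h2 := (Integrable.mul_bdd (c := C) (g := f) h hf.aestronglyMeasurable (ae_of_all _ hC))
  have h3 : (fun t : ℝ => Complex.exp (-s * t) * causal f t) =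
      (Set.Ioi (0 : ℝ)).indicator fun t : ℝ => Complex.exp (-s * t) * f t := by
    ext t
    simp only [causal, Set.indicator_apply]
    split_ifs <;> simp
  rw [h3]
  exact (integrable_indicator_iff measurableSet_Ioi).2 h2

lemma exp_mul_exp_causal (s a : ℂ) :
    (fun t : ℝ => Complex.exp (-s * t) * causal (fun t => Complex.exp (a * t)) t) =
    (Set.Ioi (0 : ℝ)).indicator fun t : ℝ => Complex.exp ((a - s) * t) := by
  ext t
  simp only [causal, Set.indicator_apply]
  split_ifs
  · rw [← Complex.exp_add]; ring_nf
  · simp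

lemma lap_exp_causal {s a : ℂ} (h : a.re < s.re) :
    lap (causal fun t => Complex.exp (a * t)) s = 1 / (s - a) := by
  have h0 : s - a ≠ 0 := fun h' => by
    have := congrArg Complex.re h'
    simp at this; linarith
  rw [lap, exp_mul_exp_causal, integral_indicator measurableSet_Ioi,
    integral_exp_mul_complex_Ioi (by simpa using h)]
  have h1 : a - s ≠ 0 := fun h' => h0 (by rw [← neg_sub, h', neg_zero])
  simp only [Complex.ofReal_zero, mul_zero, Complex.exp_zero]
  field_simp
  ring

lemma integrable_exp_mul_exp_causal {s a : ℂ} (h : a.re < s.re) :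
    Integrable fun t : ℝ => Complex.exp (-s * t) * causal (fun t => Complex.exp (a * t)) t := by
  rw [exp_mul_exp_causal]
  exact (integrable_indicator_iff measurableSet_Ioi).2
    (integrableOn_exp_mul_complex_Ioi (by simpa using h) 0)

lemma lap_const_causal {s : ℂ} (h : 0 < s.re) (c : ℂ) : lap (causal fun _ => c) s = c / s := by
  have h1 := lap_exp_causal (s := s) (a := 0) (by simpa using h)
  have h2 : lap (causal fun _ => c) s = c * lap (causal fun t => Complex.exp (0 * t)) s := by
    simp only [lap]
    rw [← integral_const_mul]
    congr 1; ext t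
    rcases le_or_gt t 0 with h | h
    · simp [causal_of_nonpos, h]
    · simp [causal_of_pos, h]; ring
  rw [h2, h1]; simp [div_eq_mul_inv]

/-- The weight is a character of `(ℝ, +)`, so it distributes over convolution. This reduces every
statement about weighted convolutions to integrable factors. -/
lemma exp_mul_conv (k f : ℝ → ℂ) (s : ℂ) (t : ℝ) :
    Complex.exp (-s * t) * conv k f t =
      conv (fun t : ℝ => Complex.exp (-s * t) * k t) (fun t : ℝ => Complex.exp (-s * t) * f t) t := by
  simp only [conv]
  rw [← integral_const_mul]
  congr 1; ext τ
  have : Complex.exp (-s * t) = Complex.exp (-s * τ) * Complex.exp (-s * ((t - τ : ℝ) : ℂ)) := by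
    rw [← Complex.exp_add]; push_cast; ring_nf
  rw [this]; ring

lemma conv_eq_convolution (k f : ℝ → ℂ) :
    conv k f = convolution k f (ContinuousLinearMap.mul ℂ ℂ) volume := by
  ext t; rw [convolution_mul]; rfl

lemma lap_conv {k f : ℝ → ℂ} {s : ℂ} (hk : Integrable fun t : ℝ => Complex.exp (-s * t) * k t)
    (hf : Integrable fun t : ℝ => Complex.exp (-s * t) * f t) :
    lap (conv k f) s = lap k s * lap f s := by
  have h : (fun t : ℝ => Complex.exp (-s * t) * conv k f t) = _ := funext (exp_mul_conv k f s)
  rw [lap, h, conv_eq_convolution, integral_convolution _ hk hf]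
  rfl

lemma integrable_exp_mul_conv {k f : ℝ → ℂ} {s : ℂ}
    (hk : Integrable fun t : ℝ => Complex.exp (-s * t) * k t)
    (hf : Integrable fun t : ℝ => Complex.exp (-s * t) * f t) :
    Integrable fun t : ℝ => Complex.exp (-s * t) * conv k f t := by
  have h : (fun t : ℝ => Complex.exp (-s * t) * conv k f t) = _ := funext (exp_mul_conv k f s)
  rw [h, conv_eq_convolution]
  exact hk.integrable_convolution _ hf

/-- A function whose Laplace transform vanishes on a vertical line is zero wherever it is
continuous. -/
lemma eq_zero_of_lap_eq_zero {f : ℝ → ℂ} {σ : ℝ}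
    (hf : Integrable fun t : ℝ => Complex.exp (-(σ : ℂ) * t) * f t)
    (h : ∀ s : ℂ, s.re = σ → lap f s = 0) {t : ℝ} (ht : ContinuousAt f t) : f t = 0 := by
  set F : ℝ → ℂ := fun t : ℝ => Complex.exp (-(σ : ℂ) * t) * f t with hF
  -- The Laplace transform along `Re s = σ` is the Fourier transform of `F`, with `s = σ + 2πiw`.
  have hfour : FourierTransform.fourier F = fun _ => (0 : ℂ) := by
    ext w
    rw [Real.fourier_eq']
    rw [← h (σ + 2 * Real.pi * w * Complex.I) (by simp), lap]
    congr 1; ext v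
    simp only [hF, smul_eq_mul, ← mul_assoc, ← Complex.exp_add]
    congr 2
    simp
    ring
  have hc : ContinuousAt F t := by
    apply ContinuousAt.mul _ ht
    fun_prop
  have h1 := hf.fourierInv_fourier_eq (by rw [hfour]; exact integrable_zero _ _ _) hc
  rw [hfour, Real.fourierInv_eq'] at h1
  simpa [hF] using h1.symm

/-- Dominated convergence. A discontinuity of `f` at `0` is allowed because causal truncation
creates one; it affects only the single point `τ = t₀`. -/
lemma continuous_conv {k f : ℝ → ℂ} (hk : Integrable k) (hfm : Measurable f) {C : ℝ}
    (hC : ∀ t, ‖f t‖ ≤ C) (hf : ∀ t ≠ 0, ContinuousAt f t) : Continuous (conv k f) := by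
  rw [continuous_iff_continuousAt]
  intro t₀
  unfold conv
  refine continuousAt_of_dominated (bound := fun τ => ‖k τ‖ * C) ?_ ?_ (hk.norm.mul_const C) ?_
  · exact Eventually.of_forall fun t =>
      hk.aestronglyMeasurable.mul (hfm.comp (measurable_const.sub measurable_id)).aestronglyMeasurable
  · refine Eventually.of_forall fun t => ae_of_all _ fun τ => ?_
    rw [norm_mul]
    exact mul_le_mul_of_nonneg_left (hC _) (norm_nonneg _)
  · have : ∀ᵐ τ : ℝ, τ ≠ t₀ := by simp [ae_iff]
    filter_upwards [this] with τ hτ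
    refine continuousAt_const.mul ?_
    exact ContinuousAt.comp (g := f) (f := fun t => t - τ) (hf _ (sub_ne_zero.2 hτ.symm))
      (by fun_prop)

lemma norm_conv_le {k f : ℝ → ℂ} (hk : Integrable k) {C : ℝ} (hC : ∀ t, ‖f t‖ ≤ C) (t : ℝ) :
    ‖conv k f t‖ ≤ (∫ τ, ‖k τ‖) * C := by
  rw [← integral_mul_const]
  refine norm_integral_le_of_norm_le (hk.norm.mul_const C) (ae_of_all _ fun τ => ?_)
  rw [norm_mul]
  exact mul_le_mul_of_nonneg_left (hC _) (norm_nonneg _)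

lemma tendsto_conv {k f : ℝ → ℂ} (hk : Integrable k) (hfm : Measurable f) {C : ℝ}
    (hC : ∀ t, ‖f t‖ ≤ C) {L : ℂ} (hf : Tendsto f atTop (𝓝 L)) :
    Tendsto (conv k f) atTop (𝓝 ((∫ τ, k τ) * L)) := by
  rw [← integral_mul_const]
  refine tendsto_integral_filter_of_dominated_convergence (fun τ => ‖k τ‖ * C) ?_ ?_
    (hk.norm.mul_const C) ?_
  · exact Eventually.of_forall fun t =>
      hk.aestronglyMeasurable.mul (hfm.comp (measurable_const.sub measurable_id)).aestronglyMeasurable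
  · refine Eventually.of_forall fun t => ae_of_all _ fun τ => ?_
    rw [norm_mul]
    exact mul_le_mul_of_nonneg_left (hC _) (norm_nonneg _)
  · refine ae_of_all _ fun τ => ?_
    exact (hf.comp (tendsto_atTop_add_const_right atTop (-τ) tendsto_id)).const_mul _

/-- For causal functions the convolution is an integral over `[0, t]`. -/
lemma conv_causal (k f : ℝ → ℂ) {t : ℝ} (ht : 0 ≤ t) :
    conv (causal k) (causal f) t = ∫ τ in (0 : ℝ)..t, k (t - τ) * f τ := by
  have h : conv (causal k) (causal f) t = ∫ τ in (0 : ℝ)..t, k τ * f (t - τ) := by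
    rw [intervalIntegral.integral_of_le ht, integral_Ioc_eq_integral_Ioo,
      ← integral_indicator measurableSet_Ioo, conv]
    congr 1; ext τ
    by_cases h1 : 0 < τ
    · by_cases h2 : τ < t
      · simp [causal_of_pos, h1, h2]
      · rw [Set.indicator_of_notMem (by simp [h2]), causal_of_nonpos f (by linarith), mul_zero]
    · rw [Set.indicator_of_notMem (by simp [h1]), causal_of_nonpos k (by linarith), zero_mul]
  rw [h]
  have := intervalIntegral.integral_comp_sub_left (a := 0) (b := t)
    (fun τ => k (t - τ) * f τ) t
  simpa using this

lemma conv_of_nonpos (k f : ℝ → ℂ) {t : ℝ} (ht : t ≤ 0) : conv (causal k) (causal f) t = 0 := by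
  rw [conv, ← integral_zero ℝ ℂ]
  congr 1; ext τ
  by_cases h1 : 0 < τ
  · rw [causal_of_nonpos f (by linarith), mul_zero]
  · rw [causal_of_nonpos k (by linarith), zero_mul]

/-! ### The Riemann–Liouville kernel and its Laplace transform. -/

/-- The kernel of the Riemann--Liouville integral. -/
def rlKernel (β : ℝ) (t : ℝ) : ℂ := ((1 / Real.Gamma β : ℝ) : ℂ) * ((t ^ (β - 1) : ℝ) : ℂ)

lemma measurable_rlKernel (β : ℝ) : Measurable (rlKernel β) := by
  unfold rlKernel
  fun_prop

lemma rlIntegral_eq_conv (β : ℝ) (f : ℝ → ℂ) {t : ℝ} (ht : 0 ≤ t) :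
    rlIntegral β 0 f t = conv (causal (rlKernel β)) (causal f) t := by
  rw [conv_causal _ _ ht, rlIntegral, ← intervalIntegral.integral_const_mul]
  simp only [rlKernel, mul_assoc]

lemma integrable_exp_mul_rlKernel {β : ℝ} (hβ : 0 < β) {s : ℂ} (hs : 0 < s.re) :
    Integrable fun t : ℝ => Complex.exp (-s * t) * causal (rlKernel β) t := by
  have h1 := integrableOn_rpow_mul_exp_neg_mul_rpow (p := 1) (s := β - 1) (b := s.re)
    (by linarith) one_pos hs
  have h2 : IntegrableOn (fun t : ℝ => (1 / Real.Gamma β) * (t ^ (β - 1) * Real.exp (-s.re * t)))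
      (Set.Ioi 0) := by
    simpa [IntegrableOn] using h1.const_mul (1 / Real.Gamma β)
  rw [← integrable_indicator_iff measurableSet_Ioi] at h2
  refine h2.mono' ?_ (ae_of_all _ fun t => ?_)
  · refine Measurable.aestronglyMeasurable ?_
    have := measurable_causal (measurable_rlKernel β)
    fun_prop
  · rcases le_or_gt t 0 with h | h
    · simp [causal_of_nonpos, h]
    · have hG := Real.Gamma_pos_of_pos hβ
      have := Real.rpow_nonneg h.le (β - 1)
      rw [causal_of_pos _ h, Set.indicator_of_mem (Set.mem_Ioi.2 h), rlKernel, norm_mul, norm_mul,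
        Complex.norm_exp, Complex.norm_real, Complex.norm_real, Real.norm_of_nonneg (by positivity),
        Real.norm_of_nonneg (by positivity)]
      simp
      apply le_of_eq; ring

lemma lap_rlKernel_ofReal {β : ℝ} (hβ : 0 < β) {r : ℝ} (hr : 0 < r) :
    lap (causal (rlKernel β)) r = (1 / (r : ℂ)) ^ (β : ℂ) := by
  have h1 := Complex.integral_cpow_mul_exp_neg_mul_Ioi (a := (β : ℂ)) (by simpa using hβ) hr
  have hG : Complex.Gamma β ≠ 0 := by
    rw [Complex.Gamma_ofReal]
    exact_mod_cast (Real.Gamma_pos_of_pos hβ).ne'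
  rw [← mul_div_cancel_right₀ ((1 / (r : ℂ)) ^ (β : ℂ)) hG, ← h1, lap,
    ← integral_indicator measurableSet_Ioi, div_eq_inv_mul, ← integral_const_mul]
  congr 1; ext t
  rcases le_or_gt t 0 with h | h
  · simp [causal_of_nonpos, h]
  · rw [causal_of_pos _ h, Set.indicator_of_mem (Set.mem_Ioi.2 h), rlKernel, Complex.Gamma_ofReal,
      Complex.ofReal_cpow h.le]
    push_cast
    ring_nf

/-- The Laplace transform is holomorphic in the half plane of absolute convergence. -/
lemma differentiableOn_lap {f : ℝ → ℂ} (hfm : Measurable f) (h0 : ∀ t ≤ 0, f t = 0)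
    (hf : ∀ s : ℂ, 0 < s.re → Integrable fun t : ℝ => Complex.exp (-s * t) * f t) :
    DifferentiableOn ℂ (lap f) {s : ℂ | 0 < s.re} := by
  intro s₀ hs₀
  have hs₀ : 0 < s₀.re := hs₀
  -- On `Re s > 2ε` the derivative carries at least two factors `exp(-εt)`: one absorbs the factor
  -- `t`, the other remains in the integrable bound.
  set ε := s₀.re / 4 with hε
  have hε0 : 0 < ε := by positivity
  have key := hasDerivAt_integral_of_dominated_loc_of_deriv_le (μ := volume) (𝕜 := ℂ)
    (F := fun (s : ℂ) (t : ℝ) => Complex.exp (-s * t) * f t)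
    (F' := fun (s : ℂ) (t : ℝ) => (-(t : ℂ) * Complex.exp (-s * (t : ℂ))) * f t) (x₀ := s₀)
    (s := {s : ℂ | 2 * ε < s.re})
    (bound := fun t : ℝ => (1 / ε) * ‖Complex.exp (-(ε : ℂ) * t) * f t‖) ?_ ?_ (hf s₀ hs₀) ?_ ?_ ?_ ?_
  · exact key.2.differentiableAt.differentiableWithinAt
  · exact (isOpen_lt continuous_const Complex.continuous_re).mem_nhds (by
      rw [Set.mem_ofPred_eq]; linarith)
  · refine Eventually.of_forall fun s => Measurable.aestronglyMeasurable ?_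
    fun_prop
  · refine Measurable.aestronglyMeasurable ?_
    fun_prop
  · refine ae_of_all _ fun t s hs => ?_
    rcases le_or_gt t 0 with h | h
    · simp [h0 t h]
    · have hs : 2 * ε < s.re := hs
      rw [norm_mul, norm_mul, norm_mul, ← mul_assoc]
      refine mul_le_mul_of_nonneg_right ?_ (norm_nonneg _)
      simp only [norm_neg, Complex.norm_real, Real.norm_of_nonneg h.le, Complex.norm_exp]
      have e1 : (-s * (t : ℂ)).re = -s.re * t := by simp
      have e2 : (-(ε : ℂ) * (t : ℂ)).re = -ε * t := by simp
      rw [e1, e2]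
      have h3 : ε * t ≤ Real.exp (ε * t) := (Real.add_one_le_exp _).trans' (by linarith)
      have h4 : Real.exp (-s.re * t) ≤ Real.exp (-ε * t) * Real.exp (-ε * t) := by
        rw [← Real.exp_add]; apply Real.exp_le_exp.2; nlinarith
      have h5 : Real.exp (ε * t) * Real.exp (-ε * t) = 1 := by
        rw [← Real.exp_add]; simp
      have h6 := Real.exp_pos (-ε * t)
      calc t * Real.exp (-s.re * t) ≤ t * (Real.exp (-ε * t) * Real.exp (-ε * t)) := by gcongr
        _ = 1 / ε * (ε * t * Real.exp (-ε * t)) * Real.exp (-ε * t) := by field_simp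
        _ ≤ 1 / ε * (Real.exp (ε * t) * Real.exp (-ε * t)) * Real.exp (-ε * t) := by gcongr
        _ = 1 / ε * Real.exp (-ε * t) := by rw [h5, mul_one]
  · exact ((hf ε (by simpa using hε0)).norm.const_mul _)
  · refine ae_of_all _ fun t s _ => ?_
    have h1 : HasDerivAt (fun s : ℂ => -s * (t : ℂ)) (-t) s := by
      simpa using ((hasDerivAt_id s).neg.mul_const (t : ℂ))
    refine (h1.cexp.mul_const (f t)).congr_deriv ?_
    ring

/-- On the positive reals this is the Gamma integral; the identity theorem carries it to the half
plane from real points accumulating at `1`. -/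
lemma lap_rlKernel {β : ℝ} (hβ : 0 < β) {s : ℂ} (hs : 0 < s.re) :
    lap (causal (rlKernel β)) s = Complex.exp (-β * Complex.log s) := by
  have hopen : IsOpen {s : ℂ | 0 < s.re} := isOpen_lt continuous_const Complex.continuous_re
  have h1 : AnalyticOnNhd ℂ (lap (causal (rlKernel β))) {s : ℂ | 0 < s.re} :=
    (differentiableOn_lap (measurable_causal (measurable_rlKernel β))
      (fun t ht => causal_of_nonpos _ ht)
      (fun s hs => integrable_exp_mul_rlKernel hβ hs)).analyticOnNhd hopen
  have h2 : AnalyticOnNhd ℂ (fun s => Complex.exp (-β * Complex.log s)) {s : ℂ | 0 < s.re} := by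
    refine DifferentiableOn.analyticOnNhd (fun s hs => ?_) hopen
    have : s ∈ Complex.slitPlane := Or.inl hs
    exact (((differentiableAt_id.clog this).const_mul _).cexp).differentiableWithinAt
  refine h1.eqOn_of_preconnected_of_frequently_eq h2
    (convex_halfSpace_re_gt 0).isPreconnected (z₀ := 1) (by simp) ?_ hs
  have hreal : ∀ r : ℝ, 0 < r →
      lap (causal (rlKernel β)) r = Complex.exp (-β * Complex.log r) := by
    intro r hr
    have hr' : (1 / (r : ℂ)) ≠ 0 := by simpa using hr.ne'
    rw [lap_rlKernel_ofReal hβ hr, Complex.cpow_def_of_ne_zero hr', one_div, Complex.log_inv _ (by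
      rw [Complex.arg_ofReal_of_nonneg hr.le]; exact Real.pi_pos.ne)]
    ring_nf
  have hT : Tendsto (fun r : ℝ => (r : ℂ)) (𝓝[>] 1) (𝓝[≠] 1) := by
    refine tendsto_nhdsWithin_iff.2 ⟨?_, ?_⟩
    · exact (Complex.continuous_ofReal.tendsto' 1 1 (by simp)).mono_left nhdsWithin_le_nhds
    · filter_upwards [self_mem_nhdsWithin] with r hr
      have : (1 : ℝ) < r := hr
      simp only [Set.mem_compl_iff, Set.mem_singleton_iff]
      exact_mod_cast this.ne'
  refine hT.frequently (Eventually.frequently ?_)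
  filter_upwards [self_mem_nhdsWithin] with r hr
  exact hreal r (lt_trans one_pos hr)

/-! ### The contour integral over the strip `|Im w| ≤ π`. -/

lemma exp_re_pos {w : ℂ} (hw : |w.im| < Real.pi / 2) : 0 < (Complex.exp w).re := by
  rw [Complex.exp_re]
  exact mul_pos (Real.exp_pos _) (Real.cos_pos_of_mem_Ioo ⟨by linarith [(abs_lt.1 hw).1], by
    linarith [(abs_lt.1 hw).2]⟩)

lemma exp_injective_of_abs_im {w w₀ : ℂ} (hw : |w.im| ≤ Real.pi) (hw₀ : |w₀.im| < Real.pi / 2)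
    (h : Complex.exp w = Complex.exp w₀) : w = w₀ := by
  have hne : w.im ≠ -Real.pi := by
    intro h'
    have h1 := exp_re_pos hw₀
    rw [← h, Complex.exp_re, h', Real.cos_neg, Real.cos_pi] at h1
    linarith [Real.exp_pos w.re]
  have h1 := Complex.log_exp (x := w) (lt_of_le_of_ne (abs_le.1 hw).1 hne.symm) (abs_le.1 hw).2
  have h2 := Complex.log_exp (x := w₀) (by linarith [(abs_lt.1 hw₀).1, Real.pi_pos])
    (by linarith [(abs_lt.1 hw₀).2, Real.pi_pos])
  rw [← h1, h, h2]

/-- Since `α < 1`, multiplication by `α` moves the closed strip strictly inside the range of the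
principal logarithm. Hence `s ^ α - λ` has no zero besides `μ`, the edges of the cut included. -/
lemma exp_mul_injective_of_abs_im {α : ℝ} (h0 : 0 < α) (h1 : α < 1) {w w₁ : ℂ}
    (hw : |w.im| ≤ Real.pi) (hw₁ : |w₁.im| ≤ Real.pi)
    (h : Complex.exp (α * w) = Complex.exp (α * w₁)) : w = w₁ := by
  have key : ∀ v : ℂ, |v.im| ≤ Real.pi → Complex.log (Complex.exp (α * v)) = α * v := by
    intro v hv
    have h3 := abs_le.1 hv
    have hpi := Real.pi_pos
    apply Complex.log_exp <;> simp <;> nlinarith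
  have h2 : (α : ℂ) * w = α * w₁ := by rw [← key w hw, h, key w₁ hw₁]
  exact mul_left_cancel₀ (by exact_mod_cast h0.ne') h2

/-- Provides nonvanishing cofactors: a denominator with one simple zero becomes `(w - a)` times a
divided difference that can be inverted. -/
lemma dslope_ne_zero {f : ℂ → ℂ} {a w : ℂ} (hd : deriv f a ≠ 0) (h : f w = f a → w = a) :
    dslope f a w ≠ 0 := by
  by_cases hw : w = a
  · rwa [hw, dslope_same]
  · rw [dslope_of_ne _ hw, slope_def_field]
    exact div_ne_zero (sub_ne_zero.2 fun h' => hw (h h')) (sub_ne_zero.2 hw)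

lemma differentiable_dslope {f : ℂ → ℂ} (hf : Differentiable ℂ f) (a : ℂ) :
    Differentiable ℂ (dslope f a) := by
  rw [← differentiableOn_univ, Complex.differentiableOn_dslope univ_mem]
  exact hf.differentiableOn

/-- The function `1 / (exp (α w) - exp (α w₁)) * exp w / (exp w - exp w₀)` minus multiples of
`exp w / (exp w - exp w₀)` and `exp w / (exp w - exp w₁)` which remove its poles in the strip
`|Im w| ≤ π`. -/
def contourFun (α : ℝ) (w₁ w₀ w : ℂ) : ℂ :=
  1 / (Complex.exp (α * w) - Complex.exp (α * w₁)) *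
      (Complex.exp w / (Complex.exp w - Complex.exp w₀)) -
    1 / (Complex.exp (α * w₀) - Complex.exp (α * w₁)) *
      (Complex.exp w / (Complex.exp w - Complex.exp w₀)) -
    Complex.exp w₁ / (α * Complex.exp (α * w₁) * (Complex.exp w₁ - Complex.exp w₀)) *
      (Complex.exp w / (Complex.exp w - Complex.exp w₁))

lemma exists_holomorphic_extension_contourFun {α : ℝ} (h0 : 0 < α) (h1 : α < 1) {w₁ w₀ : ℂ}
    (hw₁ : |w₁.im| < Real.pi / 2) (hw₀ : |w₀.im| < Real.pi / 2) (hne : w₀ ≠ w₁) :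
    ∃ H : ℂ → ℂ, DifferentiableOn ℂ H {w | |w.im| ≤ Real.pi} ∧
      ∀ w : ℂ, |w.im| ≤ Real.pi → w ≠ w₀ → w ≠ w₁ → H w = contourFun α w₁ w₀ w := by
  have hpi := Real.pi_pos
  have hα : (α : ℂ) ≠ 0 := by exact_mod_cast h0.ne'
  have hE : Differentiable ℂ fun w : ℂ => Complex.exp (α * w) := by fun_prop
  have hder : deriv (fun w : ℂ => Complex.exp (α * w)) w₁ = α * Complex.exp (α * w₁) := by
    simp [mul_comm]
  set a := dslope (fun w : ℂ => Complex.exp (α * w)) w₁ with ha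
  set b := dslope Complex.exp w₀ with hb
  set m := dslope Complex.exp w₁ with hm
  have hda : Differentiable ℂ a := differentiable_dslope hE _
  have hdb : Differentiable ℂ b := differentiable_dslope Complex.differentiable_exp _
  have hdm : Differentiable ℂ m := differentiable_dslope Complex.differentiable_exp _
  set U : Set ℂ := {w | a w ≠ 0} ∩ ({w | b w ≠ 0} ∩ {w | m w ≠ 0}) with hU
  have hUo : IsOpen U := (isOpen_ne_fun hda.continuous continuous_const).inter
    ((isOpen_ne_fun hdb.continuous continuous_const).inter
      (isOpen_ne_fun hdm.continuous continuous_const))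
  have hstrip : ∀ w : ℂ, |w.im| ≤ Real.pi → w ∈ U := by
    intro w hw
    refine ⟨dslope_ne_zero ?_ ?_, dslope_ne_zero ?_ ?_, dslope_ne_zero ?_ ?_⟩
    · rw [hder]; exact mul_ne_zero hα (Complex.exp_ne_zero _)
    · exact exp_mul_injective_of_abs_im h0 h1 hw (by linarith)
    · rw [Complex.deriv_exp]; exact Complex.exp_ne_zero _
    · exact exp_injective_of_abs_im hw hw₀
    · rw [Complex.deriv_exp]; exact Complex.exp_ne_zero _
    · exact exp_injective_of_abs_im hw hw₁
  have hU₀ := hstrip w₀ (by linarith)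
  have hU₁ := hstrip w₁ (by linarith)
  -- `A` and `B` are the residues of the product at `w₀` and `w₁`; each correcting quotient has
  -- residue `1` at its own pole.
  set A : ℂ := 1 / (Complex.exp (α * w₀) - Complex.exp (α * w₁)) with hA
  set B : ℂ := Complex.exp w₁ / (α * Complex.exp (α * w₁) * (Complex.exp w₁ - Complex.exp w₀))
    with hB
  -- Away from the poles `N w = (w - w₀)(w - w₁) contourFun w`. As `N` vanishes at both points, two
  -- successive divided differences remove the singularities.
  set N : ℂ → ℂ := fun w => Complex.exp w / (a w * b w) - A * (w - w₁) * Complex.exp w / b w -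
    B * (w - w₀) * Complex.exp w / m w with hN
  have hdN : DifferentiableOn ℂ N U := by
    intro w hw
    obtain ⟨q1, q2, q3⟩ := hw
    have q1 : a w ≠ 0 := q1
    have q2 : b w ≠ 0 := q2
    have q3 : m w ≠ 0 := q3
    have p1 := hda w
    have p2 := hdb w
    have p3 := hdm w
    refine DifferentiableAt.differentiableWithinAt ?_
    exact ((Complex.differentiableAt_exp.div (p1.mul p2) (mul_ne_zero q1 q2)).sub
      (DifferentiableAt.div (by fun_prop) p2 q2)).sub (DifferentiableAt.div (by fun_prop) p3 q3)
  have e0 : Complex.exp (α * w₀) - Complex.exp (α * w₁) ≠ 0 := sub_ne_zero.2 fun h =>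
    hne (exp_mul_injective_of_abs_im h0 h1 (by linarith) (by linarith) h)
  have e1 : Complex.exp w₁ - Complex.exp w₀ ≠ 0 := sub_ne_zero.2 fun h =>
    hne (exp_injective_of_abs_im (by linarith) hw₀ h).symm
  have d01 : w₀ - w₁ ≠ 0 := sub_ne_zero.2 hne
  have d10 : w₁ - w₀ ≠ 0 := sub_ne_zero.2 hne.symm
  have x0 := Complex.exp_ne_zero w₀
  have x1 := Complex.exp_ne_zero w₁
  have xα := Complex.exp_ne_zero (α * w₁)
  have hN0 : N w₀ = 0 := by
    have q2 : b w₀ ≠ 0 := hU₀.2.1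
    have : a w₀ = (Complex.exp (α * w₀) - Complex.exp (α * w₁)) / (w₀ - w₁) := by
      rw [ha, dslope_of_ne _ hne, slope_def_field]
    simp only [hN, this, hA, sub_self, mul_zero, zero_mul, zero_div]
    field_simp
    ring
  have hN1 : N w₁ = 0 := by
    have r1 : a w₁ = α * Complex.exp (α * w₁) := by rw [ha, dslope_same, hder]
    have r2 : b w₁ = (Complex.exp w₁ - Complex.exp w₀) / (w₁ - w₀) := by
      rw [hb, dslope_of_ne _ hne.symm, slope_def_field]
    have r3 : m w₁ = Complex.exp w₁ := by rw [hm, dslope_same, Complex.deriv_exp]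
    simp only [hN, r1, r2, r3, hB, sub_self, mul_zero, zero_mul, zero_div]
    field_simp
    ring
  refine ⟨dslope (dslope N w₀) w₁, ?_, ?_⟩
  · refine DifferentiableOn.mono ?_ hstrip
    rw [Complex.differentiableOn_dslope (hUo.mem_nhds hU₁),
      Complex.differentiableOn_dslope (hUo.mem_nhds hU₀)]
    exact hdN
  · intro w hw hww₀ hww₁
    obtain ⟨q1, q2, q3⟩ := hstrip w hw
    have q1 : a w ≠ 0 := q1
    have q2 : b w ≠ 0 := q2
    have q3 : m w ≠ 0 := q3
    have s0 : w - w₀ ≠ 0 := sub_ne_zero.2 hww₀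
    have s1 : w - w₁ ≠ 0 := sub_ne_zero.2 hww₁
    rw [dslope_of_ne _ hww₁, slope_def_field, dslope_of_ne _ hww₀, dslope_of_ne _ hne.symm,
      slope_def_field, slope_def_field, hN0, hN1]
    have r1 : Complex.exp (α * w) - Complex.exp (α * w₁) = a w * (w - w₁) := by
      rw [ha, dslope_of_ne _ hww₁, slope_def_field]; field_simp
    have r2 : Complex.exp w - Complex.exp w₀ = b w * (w - w₀) := by
      rw [hb, dslope_of_ne _ hww₀, slope_def_field]; field_simp
    have r3 : Complex.exp w - Complex.exp w₁ = m w * (w - w₁) := by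
      rw [hm, dslope_of_ne _ hww₁, slope_def_field]; field_simp
    rw [contourFun, ← hA, ← hB, r1, r2, r3]
    simp only [hN, sub_zero, zero_div]
    field_simp

lemma tendsto_div_sub_cobounded (s : ℂ) :
    Tendsto (fun E : ℂ => E / (E - s)) (Bornology.cobounded ℂ) (𝓝 1) := by
  have h1 : Tendsto (fun E : ℂ => E - s) (Bornology.cobounded ℂ) (Bornology.cobounded ℂ) := by
    simp [sub_eq_add_neg]
  have h2 : Tendsto (fun E : ℂ => 1 + s * (E - s)⁻¹) (Bornology.cobounded ℂ) (𝓝 1) := by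
    simpa using ((tendsto_inv₀_cobounded.comp h1).const_mul s).const_add 1
  refine h2.congr' ?_
  have : ∀ᶠ E in Bornology.cobounded ℂ, E ≠ s := by
    filter_upwards [show ({s}ᶜ : Set ℂ) ∈ Bornology.cobounded ℂ from
      Bornology.isBounded_singleton] with E hE using hE
  filter_upwards [this] with E hE
  have := sub_ne_zero.2 hE
  field_simp
  ring

lemma tendsto_ofReal_mul_comap_re_atTop {α : ℝ} (h0 : 0 < α) :
    Tendsto (fun w : ℂ => α * w) (comap Complex.re atTop) (comap Complex.re atTop) := by
  rw [tendsto_comap_iff]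
  have : (Complex.re ∘ fun w : ℂ => (α : ℂ) * w) = fun w : ℂ => α * w.re := by ext w; simp
  rw [this]
  exact (tendsto_id.const_mul_atTop h0).comp tendsto_comap

lemma tendsto_ofReal_mul_comap_re_atBot {α : ℝ} (h0 : 0 < α) :
    Tendsto (fun w : ℂ => α * w) (comap Complex.re atBot) (comap Complex.re atBot) := by
  rw [tendsto_comap_iff]
  have : (Complex.re ∘ fun w : ℂ => (α : ℂ) * w) = fun w : ℂ => α * w.re := by ext w; simp
  rw [this]
  exact (tendsto_id.const_mul_atBot h0).comp tendsto_comap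

/-- The product decays because of `exp(αw)`, while each correcting quotient tends to `1`. The
residues thus reappear as the contribution of the right-hand side of the rectangle. -/
lemma tendsto_contourFun_atTop {α : ℝ} (h0 : 0 < α) (w₁ w₀ : ℂ) :
    Tendsto (contourFun α w₁ w₀) (comap Complex.re atTop)
      (𝓝 (- (1 / (Complex.exp (α * w₀) - Complex.exp (α * w₁))) -
        Complex.exp w₁ / (α * Complex.exp (α * w₁) * (Complex.exp w₁ - Complex.exp w₀)))) := by
  have h1 := fun s => (tendsto_div_sub_cobounded s).comp Complex.tendsto_exp_comap_re_atTop
  have h2 : Tendsto (fun w : ℂ => Complex.exp (α * w) - Complex.exp (α * w₁))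
      (comap Complex.re atTop) (Bornology.cobounded ℂ) := by
    have h3 := Complex.tendsto_exp_comap_re_atTop.comp (tendsto_ofReal_mul_comap_re_atTop h0)
    have h4 : Tendsto (fun E : ℂ => E - Complex.exp (α * w₁)) (Bornology.cobounded ℂ)
        (Bornology.cobounded ℂ) := by
      simp [sub_eq_add_neg]
    exact h4.comp h3
  have h4 := tendsto_inv₀_cobounded.comp h2
  have h5 := ((h4.mul (h1 (Complex.exp w₀))).sub ((h1 (Complex.exp w₀)).const_mul
    (1 / (Complex.exp (α * w₀) - Complex.exp (α * w₁))))).sub ((h1 (Complex.exp w₁)).const_mul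
    (Complex.exp w₁ / (α * Complex.exp (α * w₁) * (Complex.exp w₁ - Complex.exp w₀))))
  simp only [mul_one, zero_sub] at h5
  refine h5.congr fun w => ?_
  simp [contourFun]

lemma tendsto_contourFun_atBot {α : ℝ} (h0 : 0 < α) (w₁ w₀ : ℂ) :
    Tendsto (contourFun α w₁ w₀) (comap Complex.re atBot) (𝓝 0) := by
  have h1 : ∀ s : ℂ, Tendsto (fun w => Complex.exp w / (Complex.exp w - Complex.exp s))
      (comap Complex.re atBot) (𝓝 0) := by
    intro s
    have := Complex.tendsto_exp_comap_re_atBot.div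
      (Complex.tendsto_exp_comap_re_atBot.sub_const (Complex.exp s))
      (by simp [Complex.exp_ne_zero])
    rw [zero_div] at this
    exact this
  have h2 : Tendsto (fun w : ℂ => 1 / (Complex.exp (α * w) - Complex.exp (α * w₁)))
      (comap Complex.re atBot) (𝓝 (1 / (0 - Complex.exp (α * w₁)))) := by
    have h3 := Complex.tendsto_exp_comap_re_atBot.comp (tendsto_ofReal_mul_comap_re_atBot h0)
    exact tendsto_const_nhds.div (h3.sub_const _) (by simp [Complex.exp_ne_zero])
  have h5 := ((h2.mul (h1 w₀)).sub ((h1 w₀).const_mul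
    (1 / (Complex.exp (α * w₀) - Complex.exp (α * w₁))))).sub ((h1 w₁).const_mul
    (Complex.exp w₁ / (α * Complex.exp (α * w₁) * (Complex.exp w₁ - Complex.exp w₀))))
  simp only [mul_zero, sub_zero] at h5
  exact h5

lemma measurable_contourFun (α : ℝ) (w₁ w₀ : ℂ) : Measurable (contourFun α w₁ w₀) := by
  unfold contourFun
  fun_prop

/-- Limits of integrals over vertical segments. -/
lemma tendsto_integral_vertical {f : ℂ → ℂ} (hf : Measurable f) {l : Filter ℝ}
    [l.IsCountablyGenerated] {L : ℂ} (h : Tendsto f (comap Complex.re l) (𝓝 L)) (a b : ℝ) :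
    Tendsto (fun R : ℝ => ∫ y in a..b, f (R + y * Complex.I)) l (𝓝 ((b - a) * L)) := by
  have hlim : (∫ _ in a..b, L) = (b - a) * L := by simp
  rw [← hlim]
  have hb : ∀ᶠ w in comap Complex.re l, ‖f w‖ ≤ ‖L‖ + 1 := by
    filter_upwards [h.norm.eventually (eventually_lt_nhds (lt_add_one ‖L‖))] with w hw using hw.le
  refine intervalIntegral.tendsto_integral_filter_of_dominated_convergence
    (fun _ => ‖L‖ + 1) ?_ ?_ (by simp) ?_
  · refine Eventually.of_forall fun R => Measurable.aestronglyMeasurable ?_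
    exact hf.comp (by fun_prop)
  · rw [eventually_comap] at hb
    filter_upwards [hb] with R hR
    exact ae_of_all _ fun y _ => hR _ (by simp)
  · refine ae_of_all _ fun y _ => h.comp ?_
    rw [tendsto_comap_iff]
    refine tendsto_id.congr fun R => ?_
    simp

/-- The jump of `1 / (exp (α w) - exp (α w₁))` between the lines `Im w = -π` and `Im w = π`. -/
def jump (α : ℝ) (w₁ : ℂ) (u : ℝ) : ℂ :=
  1 / (Complex.exp (α * (u + ((-Real.pi : ℝ) : ℂ) * Complex.I)) - Complex.exp (α * w₁)) -
    1 / (Complex.exp (α * (u + (Real.pi : ℂ) * Complex.I)) - Complex.exp (α * w₁))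

lemma exp_sub_ne_zero_of_im {α : ℝ} (h0 : 0 < α) (h1 : α < 1) {w₁ : ℂ}
    (hw₁ : |w₁.im| < Real.pi / 2) {y : ℝ} (hy : |y| = Real.pi) (u : ℝ) :
    Complex.exp (α * (u + (y : ℂ) * Complex.I)) - Complex.exp (α * w₁) ≠ 0 := by
  refine sub_ne_zero.2 fun h => ?_
  have h2 := exp_mul_injective_of_abs_im h0 h1 (by simp [hy]) (by linarith [Real.pi_pos]) h
  rw [← h2] at hw₁
  simp [hy] at hw₁
  linarith [Real.pi_pos]

lemma continuous_jump {α : ℝ} (h0 : 0 < α) (h1 : α < 1) {w₁ : ℂ}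
    (hw₁ : |w₁.im| < Real.pi / 2) : Continuous (jump α w₁) := by
  refine Continuous.sub ?_ ?_
  · exact Continuous.div (by fun_prop) (by fun_prop) fun u =>
      exp_sub_ne_zero_of_im h0 h1 hw₁ (by simp [abs_of_pos Real.pi_pos]) u
  · exact Continuous.div (by fun_prop) (by fun_prop) fun u =>
      exp_sub_ne_zero_of_im h0 h1 hw₁ (by simp [abs_of_pos Real.pi_pos]) u

lemma tendsto_line_comap_re (y : ℝ) (l : Filter ℝ) :
    Tendsto (fun u : ℝ => (u : ℂ) + (y : ℂ) * Complex.I) l (comap Complex.re l) := by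
  rw [tendsto_comap_iff]
  exact tendsto_id.congr fun R => by simp

lemma norm_exp_line (α y u : ℝ) :
    ‖Complex.exp (α * (u + (y : ℂ) * Complex.I))‖ = Real.exp (α * u) := by
  rw [Complex.norm_exp]; simp

lemma isBigO_inv_exp_sub_atTop {α : ℝ} (h0 : 0 < α) (w₁ : ℂ) (y : ℝ) :
    (fun u : ℝ => 1 / (Complex.exp (α * (u + (y : ℂ) * Complex.I)) - Complex.exp (α * w₁)))
      =O[atTop] fun u => Real.exp (-α * u) := by
  have h1 : Tendsto (fun u : ℝ => Complex.exp (α * (u + (y : ℂ) * Complex.I)) /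
      (Complex.exp (α * (u + (y : ℂ) * Complex.I)) - Complex.exp (α * w₁))) atTop (𝓝 1) :=
    (tendsto_div_sub_cobounded (Complex.exp (α * w₁))).comp (Complex.tendsto_exp_comap_re_atTop.comp
      ((tendsto_ofReal_mul_comap_re_atTop h0).comp (tendsto_line_comap_re y atTop)))
  refine Asymptotics.IsBigO.of_bound 2 ?_
  filter_upwards [h1.norm.eventually (eventually_lt_nhds (b := 2) (by norm_num))] with u hu
  rw [norm_div, norm_exp_line] at hu
  rw [norm_div, norm_one, Real.norm_of_nonneg (Real.exp_pos _).le]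
  have h3 : Real.exp (-α * u) * Real.exp (α * u) = 1 := by rw [← Real.exp_add]; simp
  calc _ = Real.exp (-α * u) * (Real.exp (α * u) /
        ‖Complex.exp (α * (u + (y : ℂ) * Complex.I)) - Complex.exp (α * w₁)‖) := by
        rw [← mul_div_assoc, h3]
    _ ≤ Real.exp (-α * u) * 2 := by gcongr
    _ = _ := mul_comm _ _

lemma tendsto_inv_exp_sub_atBot {α : ℝ} (h0 : 0 < α) (w₁ : ℂ) (y : ℝ) :
    Tendsto (fun u : ℝ => 1 / (Complex.exp (α * (u + (y : ℂ) * Complex.I)) - Complex.exp (α * w₁)))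
      atBot (𝓝 (1 / (0 - Complex.exp (α * w₁)))) := by
  have h3 := Complex.tendsto_exp_comap_re_atBot.comp
    ((tendsto_ofReal_mul_comap_re_atBot h0).comp (tendsto_line_comap_re y atBot))
  exact tendsto_const_nhds.div (h3.sub_const _) (by simp [Complex.exp_ne_zero])

/-- Neither term decays at `-∞`, but both have the same limit. Over a common denominator the
numerator is a difference of two exponentials of modulus `exp(αu)`. -/
lemma isBigO_jump_atBot {α : ℝ} (h0 : 0 < α) (h1 : α < 1) {w₁ : ℂ}
    (hw₁ : |w₁.im| < Real.pi / 2) : jump α w₁ =O[atBot] fun u => Real.exp (α * u) := by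
  set M := ‖1 / (0 - Complex.exp (α * w₁))‖ + 1 with hM
  refine Asymptotics.IsBigO.of_bound (2 * M ^ 2) ?_
  have hb := fun y => (tendsto_inv_exp_sub_atBot h0 w₁ y).norm.eventually
    (eventually_lt_nhds (lt_add_one _))
  filter_upwards [hb (-Real.pi), hb Real.pi] with u hu hu'
  set E₁ := Complex.exp (α * (u + ((-Real.pi : ℝ) : ℂ) * Complex.I)) with hE₁
  set E₂ := Complex.exp (α * (u + (Real.pi : ℂ) * Complex.I)) with hE₂
  have n1 : ‖E₁‖ = Real.exp (α * u) := norm_exp_line _ _ _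
  have n2 : ‖E₂‖ = Real.exp (α * u) := norm_exp_line _ _ _
  have z1 : E₁ - Complex.exp (α * w₁) ≠ 0 :=
    exp_sub_ne_zero_of_im h0 h1 hw₁ (by simp [abs_of_pos Real.pi_pos]) u
  have z2 : E₂ - Complex.exp (α * w₁) ≠ 0 :=
    exp_sub_ne_zero_of_im h0 h1 hw₁ (by simp [abs_of_pos Real.pi_pos]) u
  have e : jump α w₁ u = (E₂ - E₁) * (1 / (E₁ - Complex.exp (α * w₁))) *
      (1 / (E₂ - Complex.exp (α * w₁))) := by
    rw [jump, ← hE₁, ← hE₂]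
    field_simp
    ring
  rw [e, norm_mul, norm_mul, Real.norm_of_nonneg (Real.exp_pos _).le]
  calc _ ≤ (Real.exp (α * u) + Real.exp (α * u)) * M * M := by
        gcongr
        exact (norm_sub_le _ _).trans (by rw [n1, n2])
    _ = _ := by ring

lemma integrable_jump {α : ℝ} (h0 : 0 < α) (h1 : α < 1) {w₁ : ℂ}
    (hw₁ : |w₁.im| < Real.pi / 2) : Integrable (jump α w₁) := by
  refine LocallyIntegrable.integrable_of_isBigO_atBot_atTop
    (continuous_jump h0 h1 hw₁).locallyIntegrable (isBigO_jump_atBot h0 h1 hw₁) ?_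
    ((isBigO_inv_exp_sub_atTop h0 w₁ _).sub (isBigO_inv_exp_sub_atTop h0 w₁ _)) ?_
  · exact ⟨Set.Iic 0, Iic_mem_atBot 0, integrableOn_exp_mul_Iic h0 0⟩
  · exact ⟨Set.Ioi 0, Ioi_mem_atTop 0, integrableOn_exp_mul_Ioi (by linarith) 0⟩

/-- The Cauchy integral formula for `1 / (exp (α w) - exp (α w₁))` on the strip `|Im w| ≤ π`. -/
lemma integral_jump {α : ℝ} (h0 : 0 < α) (h1 : α < 1) {w₁ w₀ : ℂ}
    (hw₁ : |w₁.im| < Real.pi / 2) (hw₀ : |w₀.im| < Real.pi / 2) (hne : w₀ ≠ w₁) :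
    ∫ u : ℝ, jump α w₁ u * (Complex.exp u / (Complex.exp u + Complex.exp w₀)) =
      2 * Real.pi * Complex.I * (1 / (Complex.exp (α * w₀) - Complex.exp (α * w₁)) -
        Complex.exp w₁ / (α * Complex.exp (α * w₁)) / (Complex.exp w₀ - Complex.exp w₁)) := by
  have hpi := Real.pi_pos
  obtain ⟨H, hH, hHG⟩ := exists_holomorphic_extension_contourFun h0 h1 hw₁ hw₀ hne
  have hden : ∀ (v : ℂ), |v.im| < Real.pi / 2 → ∀ u : ℝ, Complex.exp u + Complex.exp v ≠ 0 := by
    intro v hv u h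
    have h2 := congrArg Complex.re h
    rw [Complex.add_re, Complex.zero_re, ← Complex.ofReal_exp, Complex.ofReal_re] at h2
    linarith [Real.exp_pos u, exp_re_pos hv]
  set Φ : ℝ → ℂ := fun u => jump α w₁ u * (Complex.exp u / (Complex.exp u + Complex.exp w₀)) with hΦ
  -- On both edges `exp w = -exp u`, so the correcting terms agree there and cancel, leaving only
  -- the jump.
  have hline : ∀ (y : ℝ), |y| = Real.pi → ∀ u : ℝ,
      Complex.exp ((u : ℂ) + (y : ℂ) * Complex.I) = - Complex.exp u := by
    intro y hy u
    rw [Complex.exp_add]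
    rcases (abs_eq hpi.le).1 hy with h | h
    · rw [h, Complex.exp_pi_mul_I]; ring
    · rw [h]; push_cast
      rw [neg_mul, Complex.exp_neg, Complex.exp_pi_mul_I]; norm_num
  have hnotin : ∀ (y : ℝ), |y| = Real.pi → ∀ (u : ℝ) (v : ℂ), |v.im| < Real.pi / 2 →
      (u : ℂ) + (y : ℂ) * Complex.I ≠ v := by
    intro y hy u v hv h
    rw [← h] at hv
    simp [hy] at hv
    linarith
  have hsides : ∀ u : ℝ, H (u + ((-Real.pi : ℝ) : ℂ) * Complex.I) -
      H (u + (Real.pi : ℂ) * Complex.I) = Φ u := by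
    intro u
    have a1 : |(-Real.pi)| = Real.pi := by simp [abs_of_pos hpi]
    have a2 : |Real.pi| = Real.pi := by simp [abs_of_pos hpi]
    rw [hHG _ (by simp [abs_of_pos hpi]) (hnotin _ a1 u _ hw₀) (hnotin _ a1 u _ hw₁),
      hHG _ (by simp [abs_of_pos hpi]) (hnotin _ a2 u _ hw₀) (hnotin _ a2 u _ hw₁)]
    have r : -Complex.exp u / (-Complex.exp u - Complex.exp w₀) =
        Complex.exp u / (Complex.exp u + Complex.exp w₀) := by
      rw [← neg_div_neg_eq]; congr 1 <;> ring
    simp only [contourFun, hline _ a1, hline _ a2, hΦ, jump, r]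
    ring
  have hrect : ∀ R : ℝ, (∫ u in (-R)..R, Φ u) +
      Complex.I * (∫ y in (-Real.pi)..Real.pi, H (R + y * Complex.I)) -
      Complex.I * (∫ y in (-Real.pi)..Real.pi, H ((-R : ℝ) + y * Complex.I)) = 0 := by
    intro R
    have hmem : ∀ y ∈ Set.uIcc (-Real.pi) Real.pi, |y| ≤ Real.pi := by
      intro y hy
      rw [Set.uIcc_of_le (by linarith)] at hy
      exact abs_le.2 hy
    have h2 := Complex.integral_boundary_rect_eq_zero_of_differentiableOn H
      ⟨-R, -Real.pi⟩ ⟨R, Real.pi⟩ (hH.mono fun w hw => hmem _ hw.2)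
    have hint : ∀ y : ℝ, |y| = Real.pi → IntervalIntegrable
        (fun u : ℝ => H (u + (y : ℂ) * Complex.I)) volume (-R) R := by
      intro y hy
      refine Continuous.intervalIntegrable ?_ _ _
      refine hH.continuousOn.comp_continuous (by fun_prop) fun u => ?_
      change |((u : ℂ) + (y : ℂ) * Complex.I).im| ≤ Real.pi
      simp [hy]
    rw [← intervalIntegral.integral_sub (hint _ (by simp [abs_of_pos hpi]))
      (hint _ (by simp [abs_of_pos hpi]))] at h2
    simp only [hsides, smul_eq_mul] at h2
    exact h2
  -- Once `R` differs from the real parts of the poles, `H` coincides with `contourFun` on the whole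
  -- vertical side, so the limits of `contourFun` apply.
  have hvert : ∀ {l : Filter ℝ} [l.IsCountablyGenerated] {L : ℂ},
      Tendsto (contourFun α w₁ w₀) (comap Complex.re l) (𝓝 L) →
      (∀ c : ℝ, ∀ᶠ R in l, R ≠ c) →
      Tendsto (fun R : ℝ => ∫ y in (-Real.pi)..Real.pi, H (R + y * Complex.I)) l
        (𝓝 (2 * Real.pi * L)) := by
    intro l _ L hL hl
    have h2 := tendsto_integral_vertical (measurable_contourFun α w₁ w₀) hL (-Real.pi) Real.pi
    have e : (((Real.pi : ℝ) : ℂ) - ((-Real.pi : ℝ) : ℂ)) * L = 2 * Real.pi * L := by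
      push_cast; ring
    rw [e] at h2
    refine h2.congr' ?_
    filter_upwards [hl w₀.re, hl w₁.re] with R hR hR'
    refine intervalIntegral.integral_congr fun y hy => ?_
    rw [Set.uIcc_of_le (by linarith)] at hy
    refine (hHG _ ?_ ?_ ?_).symm
    · simpa using abs_le.2 hy
    · rintro h; apply hR; rw [← h]; simp
    · rintro h; apply hR'; rw [← h]; simp
  have v1 := hvert (tendsto_contourFun_atTop h0 w₁ w₀) (fun c => eventually_ne_atTop c)
  have v2 := (hvert (tendsto_contourFun_atBot h0 w₁ w₀) (fun c => eventually_ne_atBot c)).comp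
    tendsto_neg_atTop_atBot
  have hΦi : Integrable Φ := by
    have hc : Continuous fun u : ℝ => Complex.exp u / (Complex.exp u + Complex.exp w₀) :=
      Continuous.div (by fun_prop) (by fun_prop) (hden w₀ hw₀)
    have hre : 0 < (Complex.exp w₀).re := exp_re_pos hw₀
    refine (integrable_jump h0 h1 hw₁).mul_bdd (c := 1) hc.aestronglyMeasurable
      (ae_of_all _ fun u => ?_)
    rw [norm_div, div_le_one (norm_pos_iff.2 (hden w₀ hw₀ u))]
    refine le_trans ?_ (Complex.re_le_norm _)
    rw [Complex.add_re, ← Complex.ofReal_exp, Complex.ofReal_re, Complex.norm_real,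
      Real.norm_of_nonneg (Real.exp_pos _).le]
    linarith
  have hlim := intervalIntegral_tendsto_integral hΦi tendsto_neg_atTop_atBot tendsto_id
  have htot := (hlim.add (v1.const_mul Complex.I)).sub (v2.const_mul Complex.I)
  have hzero := tendsto_nhds_unique (htot.congr fun R => hrect R) tendsto_const_nhds
  have e1 : Complex.exp w₁ - Complex.exp w₀ ≠ 0 := sub_ne_zero.2 fun h =>
    hne (exp_injective_of_abs_im (by linarith) hw₀ h).symm
  have e2 : Complex.exp w₁ / (α * Complex.exp (α * w₁)) / (Complex.exp w₀ - Complex.exp w₁) =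
      - (Complex.exp w₁ / (α * Complex.exp (α * w₁) * (Complex.exp w₁ - Complex.exp w₀))) := by
    rw [div_div, ← neg_sub (Complex.exp w₁), mul_neg, div_neg]
  rw [e2]
  linear_combination hzero

/-! ### The integrable kernel and its Laplace transform. -/

/-- The integrable part of the resolvent kernel, before normalization. -/
def stableKernel (α : ℝ) (w₁ : ℂ) : ℝ → ℂ :=
  causal fun t => ∫ u : ℝ, jump α w₁ u * (Complex.exp u * Complex.exp (-(Complex.exp u * t)))

lemma integrable_exp_mul_of_causal {h : ℝ → ℂ} (hh : Integrable h) (h0 : ∀ t ≤ 0, h t = 0) {s : ℂ}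
    (hs : 0 ≤ s.re) : Integrable fun t : ℝ => Complex.exp (-s * t) * h t := by
  refine hh.norm.mono' ?_ (ae_of_all _ fun t => ?_)
  · exact (Continuous.aestronglyMeasurable (by fun_prop)).mul hh.aestronglyMeasurable
  · rcases le_or_gt t 0 with ht | ht
    · simp [h0 t ht]
    · rw [norm_mul, Complex.norm_exp]
      refine mul_le_of_le_one_left (norm_nonneg _) (Real.exp_le_one_iff.2 ?_)
      simp
      positivity

/-- Each density `exp(u) exp(-exp(u) t)` has mass `1` on `(0, ∞)`, so by Tonelli the joint norm is
the `L¹` norm of the jump. This yields both the integrability of the kernel and the Fubini step for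
its transform. -/
lemma integrable_jump_kernel {α : ℝ} (h0 : 0 < α) (h1 : α < 1) {w₁ : ℂ}
    (hw₁ : |w₁.im| < Real.pi / 2) :
    Integrable (fun p : ℝ × ℝ => jump α w₁ p.1 *
      (Complex.exp p.1 * Complex.exp (-(Complex.exp p.1 * p.2))))
      (volume.prod (volume.restrict (Set.Ioi 0))) := by
  have hm : AEStronglyMeasurable (fun p : ℝ × ℝ => jump α w₁ p.1 *
      (Complex.exp p.1 * Complex.exp (-(Complex.exp p.1 * p.2))))
      (volume.prod (volume.restrict (Set.Ioi 0))) := by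
    have := continuous_jump h0 h1 hw₁
    exact Continuous.aestronglyMeasurable (by fun_prop)
  have hre : ∀ u : ℝ, (-Complex.exp u).re < 0 := by
    intro u
    rw [← Complex.ofReal_exp, Complex.neg_re, Complex.ofReal_re]
    linarith [Real.exp_pos u]
  rw [integrable_prod_iff hm]
  constructor
  · refine ae_of_all _ fun u => ?_
    have := (integrableOn_exp_mul_complex_Ioi (hre u) 0).const_mul (jump α w₁ u * Complex.exp u)
    simpa [IntegrableOn, mul_assoc] using this
  · refine (integrable_jump h0 h1 hw₁).norm.congr (ae_of_all _ fun u => ?_)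
    have e : ∀ t : ℝ, ‖jump α w₁ u * (Complex.exp u * Complex.exp (-(Complex.exp u * t)))‖ =
        ‖jump α w₁ u‖ * Real.exp u * Real.exp (-Real.exp u * t) := by
      intro t
      rw [norm_mul, norm_mul, ← Complex.ofReal_exp, Complex.norm_real, Complex.norm_exp,
        Real.norm_of_nonneg (Real.exp_pos u).le, mul_assoc]
      simp [Complex.exp_ofReal_re]
    simp only [e]
    rw [integral_const_mul, integral_exp_mul_Ioi (by linarith [Real.exp_pos u])]
    have := (Real.exp_pos u).ne'
    field_simp
    simp

lemma integrable_stableKernel {α : ℝ} (h0 : 0 < α) (h1 : α < 1) {w₁ : ℂ}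
    (hw₁ : |w₁.im| < Real.pi / 2) : Integrable (stableKernel α w₁) :=
  (integrable_indicator_iff measurableSet_Ioi).2
    (integrable_jump_kernel h0 h1 hw₁).integral_prod_right

lemma lap_stableKernel {α : ℝ} (h0 : 0 < α) (h1 : α < 1) {w₁ : ℂ}
    (hw₁ : |w₁.im| < Real.pi / 2) {s : ℂ} (hs : 0 ≤ s.re) :
    lap (stableKernel α w₁) s =
      ∫ u : ℝ, jump α w₁ u * (Complex.exp u / (Complex.exp u + s)) := by
  have h2 : lap (stableKernel α w₁) s = ∫ t in Set.Ioi (0 : ℝ), ∫ u : ℝ,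
      Complex.exp (-s * t) *
        (jump α w₁ u * (Complex.exp u * Complex.exp (-(Complex.exp u * t)))) := by
    rw [lap, ← integral_indicator measurableSet_Ioi]
    congr 1; ext t
    rcases le_or_gt t 0 with ht | ht
    · simp [stableKernel, causal_of_nonpos, ht]
    · rw [stableKernel, causal_of_pos _ ht, Set.indicator_of_mem (Set.mem_Ioi.2 ht),
        integral_const_mul]
  rw [h2, integral_integral_swap]
  · congr 1; ext u
    have hre : (-(Complex.exp u + s)).re < 0 := by
      rw [← Complex.ofReal_exp, Complex.neg_re, Complex.add_re, Complex.ofReal_re]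
      linarith [Real.exp_pos u]
    have hne : Complex.exp u + s ≠ 0 := fun h => by rw [h] at hre; simp at hre
    have e : ∀ t : ℝ, Complex.exp (-s * t) *
        (jump α w₁ u * (Complex.exp u * Complex.exp (-(Complex.exp u * t)))) =
        jump α w₁ u * Complex.exp u * Complex.exp (-(Complex.exp u + s) * t) := by
      intro t
      have : -(Complex.exp u + s) * t = -s * t + -(Complex.exp u * t) := by ring
      rw [this, Complex.exp_add]; ring
    simp only [e]
    rw [integral_const_mul, integral_exp_mul_complex_Ioi hre]
    simp only [Complex.ofReal_zero, mul_zero, Complex.exp_zero]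
    rw [neg_div_neg_eq]
    ring
  · have h3 := (integrable_jump_kernel h0 h1 hw₁).swap
    have h4 : AEStronglyMeasurable (fun p : ℝ × ℝ => Complex.exp (-s * p.1))
        ((volume.restrict (Set.Ioi 0)).prod volume) :=
      Continuous.aestronglyMeasurable (by fun_prop)
    refine Integrable.bdd_mul (c := 1) h3 h4 ?_
    have h5 : ∀ᵐ p : ℝ × ℝ ∂((volume.restrict (Set.Ioi 0)).prod volume), 0 < p.1 :=
      Measure.quasiMeasurePreserving_fst.ae (ae_restrict_mem measurableSet_Ioi)
    filter_upwards [h5] with p hp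
    rw [Complex.norm_exp]
    refine Real.exp_le_one_iff.2 ?_
    simp
    positivity

/-- The integrable part of the resolvent kernel. -/
lemma exists_stable_kernel {α : ℝ} (h0 : 0 < α) (h1 : α < 1) {w₁ : ℂ}
    (hw₁ : |w₁.im| < Real.pi / 2) :
    ∃ h : ℝ → ℂ, Integrable h ∧ (∀ t ≤ 0, h t = 0) ∧
      ∀ w₀ : ℂ, |w₀.im| < Real.pi / 2 → w₀ ≠ w₁ → lap h (Complex.exp w₀) =
        1 / (Complex.exp (α * w₀) - Complex.exp (α * w₁)) -
        Complex.exp w₁ / (α * Complex.exp (α * w₁)) / (Complex.exp w₀ - Complex.exp w₁) := by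
  have hpi : (2 * Real.pi * Complex.I : ℂ) ≠ 0 := Complex.two_pi_I_ne_zero
  refine ⟨fun t => (2 * Real.pi * Complex.I)⁻¹ * stableKernel α w₁ t,
    (integrable_stableKernel h0 h1 hw₁).const_mul _, ?_, ?_⟩
  · intro t ht
    simp [stableKernel, causal_of_nonpos, ht]
  · intro w₀ hw₀ hne
    have e := lap_stableKernel h0 h1 hw₁ (exp_re_pos hw₀).le
    rw [integral_jump h0 h1 hw₁ hw₀ hne] at e
    have e2 : lap (fun t => (2 * Real.pi * Complex.I)⁻¹ * stableKernel α w₁ t) (Complex.exp w₀) =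
        (2 * Real.pi * Complex.I)⁻¹ * lap (stableKernel α w₁) (Complex.exp w₀) := by
      simp only [lap]
      rw [← integral_const_mul]
      congr 1; ext t; ring
    rw [e2, e, inv_mul_cancel_left₀ hpi]

/-- The Laplace transform of an integrable causal function at the boundary point `0`. -/
lemma tendsto_lap_integral {h : ℝ → ℂ} (hh : Integrable h) (h0 : ∀ t ≤ 0, h t = 0) :
    Tendsto (fun r : ℝ => lap h (Real.exp r)) atBot (𝓝 (∫ t, h t)) := by
  refine tendsto_integral_filter_of_dominated_convergence (fun t => ‖h t‖) ?_ ?_ hh.norm ?_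
  · exact Eventually.of_forall fun r =>
      (Continuous.aestronglyMeasurable (by fun_prop)).mul hh.aestronglyMeasurable
  · refine Eventually.of_forall fun r => ae_of_all _ fun t => ?_
    rcases le_or_gt t 0 with ht | ht
    · simp [h0 t ht]
    · rw [norm_mul, Complex.norm_exp]
      refine mul_le_of_le_one_left (norm_nonneg _) (Real.exp_le_one_iff.2 ?_)
      rw [← Complex.ofReal_neg, Complex.re_ofReal_mul, Complex.ofReal_re]
      have := mul_pos (Real.exp_pos r) ht
      linarith
  · refine ae_of_all _ fun t => ?_
    have h1 : Tendsto (fun r : ℝ => ((Real.exp r : ℝ) : ℂ)) atBot (𝓝 ((0 : ℝ) : ℂ)) :=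
      (Complex.continuous_ofReal.tendsto 0).comp Real.tendsto_exp_atBot
    have h2 : Tendsto (fun r : ℝ => Complex.exp (-((Real.exp r : ℝ) : ℂ) * t) * h t) atBot
        (𝓝 (Complex.exp (-((0 : ℝ) : ℂ) * t) * h t)) :=
      ((Complex.continuous_exp.tendsto _).comp ((h1.neg).mul_const _)).mul_const _
    simpa using h2

/-- The integral is the limit of the transform as `s → 0+`, read off from the explicit formula. Its
exact value is needed for the decay of the bounded solution. -/
lemma integral_stable_kernel {α : ℝ} (h0 : 0 < α) {w₁ : ℂ} {h : ℝ → ℂ} (hh : Integrable h)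
    (hc : ∀ t ≤ 0, h t = 0)
    (hl : ∀ w₀ : ℂ, |w₀.im| < Real.pi / 2 → w₀ ≠ w₁ → lap h (Complex.exp w₀) =
        1 / (Complex.exp (α * w₀) - Complex.exp (α * w₁)) -
        Complex.exp w₁ / (α * Complex.exp (α * w₁)) / (Complex.exp w₀ - Complex.exp w₁)) :
    ∫ t, h t = - (1 / Complex.exp (α * w₁)) + 1 / (α * Complex.exp (α * w₁)) := by
  refine tendsto_nhds_unique (tendsto_lap_integral hh hc) ?_
  have hT : ∀ a : ℝ, 0 < a → Tendsto (fun r : ℝ => Complex.exp (a * (r : ℂ))) atBot (𝓝 0) := by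
    intro a ha
    have h1 := (Complex.continuous_ofReal.tendsto 0).comp
      (Real.tendsto_exp_atBot.comp (tendsto_id.const_mul_atBot ha))
    refine (h1.congr fun r => ?_).trans (by simp)
    simp
  have h1 : Tendsto (fun r : ℝ => 1 / (Complex.exp (α * (r : ℂ)) - Complex.exp (α * w₁)) -
      Complex.exp w₁ / (α * Complex.exp (α * w₁)) / (Complex.exp ((1 : ℝ) * (r : ℂ)) -
        Complex.exp w₁)) atBot (𝓝 (1 / (0 - Complex.exp (α * w₁)) -
      Complex.exp w₁ / (α * Complex.exp (α * w₁)) / (0 - Complex.exp w₁))) :=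
    (tendsto_const_nhds.div ((hT α h0).sub_const _) (by simp [Complex.exp_ne_zero])).sub
      (tendsto_const_nhds.div ((hT 1 one_pos).sub_const _) (by simp [Complex.exp_ne_zero]))
  have hlim : 1 / (0 - Complex.exp (α * w₁)) -
      Complex.exp w₁ / (α * Complex.exp (α * w₁)) / (0 - Complex.exp w₁) =
      - (1 / Complex.exp (α * w₁)) + 1 / (α * Complex.exp (α * w₁)) := by
    have := Complex.exp_ne_zero w₁
    have := Complex.exp_ne_zero (α * w₁)
    have : (α : ℂ) ≠ 0 := by exact_mod_cast h0.ne'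
    field_simp
    ring
  rw [← hlim]
  refine h1.congr' ?_
  filter_upwards [eventually_ne_atBot w₁.re] with r hr
  have h2 := hl r (by simp [Real.pi_pos]) (fun h => hr (by rw [← h]; simp))
  rw [Complex.ofReal_exp, h2]
  simp

/-! ### The Caputo equation on the Laplace side, and uniqueness. -/

/-- The kernel need not be integrable: weighting both factors by `exp(-t)` reduces to
`continuous_conv`, and causality keeps the weighted `f` bounded. -/
lemma continuous_conv_causal {k f : ℝ → ℂ}
    (hk : Integrable fun t : ℝ => Complex.exp (-(1 : ℂ) * t) * k t) (hf : Continuous f) {C : ℝ}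
    (hC : ∀ t, ‖f t‖ ≤ C) : Continuous (conv k (causal f)) := by
  have hC0 : 0 ≤ C := (norm_nonneg _).trans (hC 0)
  have h1 : Continuous (conv (fun t : ℝ => Complex.exp (-(1 : ℂ) * t) * k t)
      (fun t : ℝ => Complex.exp (-(1 : ℂ) * t) * causal f t)) := by
    refine continuous_conv (C := C) hk ?_ ?_ ?_
    · have := measurable_causal hf.measurable
      fun_prop
    · intro t
      rcases le_or_gt t 0 with ht | ht
      · simpa [causal_of_nonpos f ht] using hC0
      · rw [causal_of_pos f ht, norm_mul, Complex.norm_exp]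
        refine (mul_le_of_le_one_left (norm_nonneg _) (Real.exp_le_one_iff.2 ?_)).trans (hC t)
        simpa using ht.le
    · exact fun t ht => ContinuousAt.mul (by fun_prop) (continuousAt_causal hf ht)
  have h2 : conv k (causal f) = fun t : ℝ => Complex.exp t *
      conv (fun t : ℝ => Complex.exp (-(1 : ℂ) * t) * k t)
      (fun t : ℝ => Complex.exp (-(1 : ℂ) * t) * causal f t) t := by
    ext t
    rw [← exp_mul_conv, ← mul_assoc, ← Complex.exp_add]
    simp
  rw [h2]
  fun_prop

lemma continuous_conv_rlKernel {β : ℝ} (hβ : 0 < β) {f : ℝ → ℂ} (hf : Continuous f) {C : ℝ}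
    (hC : ∀ t, ‖f t‖ ≤ C) : Continuous (conv (causal (rlKernel β)) (causal f)) :=
  continuous_conv_causal (integrable_exp_mul_rlKernel hβ (by simp)) hf hC

lemma integral_eq_conv (f : ℝ → ℂ) {t : ℝ} (ht : 0 ≤ t) :
    ∫ τ in (0 : ℝ)..t, f τ = conv (causal fun _ => 1) (causal f) t := by
  rw [conv_causal _ _ ht]; simp

/-- For bounded continuous functions the Caputo equation is equivalent to its integrated form. -/
lemma hasCaputoDerivAt_iff_conv {α : ℝ} (h1 : α < 1) {X f : ℝ → ℂ} (hX : Continuous X)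
    (hf : Continuous f) {C : ℝ} (hC : ∀ t, ‖X t‖ ≤ C) :
    (∀ t > 0, HasCaputoDerivAt α 0 X (f t) t) ↔
      conv (causal (rlKernel (1 - α))) (causal fun τ => X τ - X 0) =
        conv (causal fun _ => 1) (causal f) := by
  have hYc : Continuous (conv (causal (rlKernel (1 - α))) (causal fun τ => X τ - X 0)) :=
    continuous_conv_rlKernel (by linarith) (hX.sub continuous_const) (C := C + C)
      fun t => (norm_sub_le _ _).trans (add_le_add (hC _) (hC _))
  have hrl : ∀ t > 0, rlIntegral (1 - α) 0 (fun τ => X τ - X 0) =ᶠ[𝓝 t]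
      conv (causal (rlKernel (1 - α))) (causal fun τ => X τ - X 0) := by
    intro t ht
    filter_upwards [Ioi_mem_nhds ht] with τ hτ using rlIntegral_eq_conv _ _ (le_of_lt hτ)
  constructor
  · intro h
    ext t
    rcases le_or_gt t 0 with ht | ht
    · rw [conv_of_nonpos _ _ ht, conv_of_nonpos _ _ ht]
    -- The derivative is known only for positive times; continuity down to `0`, where the
    -- convolution vanishes, fixes the constant of integration.
    · rw [← integral_eq_conv f ht.le, intervalIntegral.integral_eq_sub_of_hasDerivAt_of_le ht.le
        hYc.continuousOn (fun τ hτ => ((h τ hτ.1).congr_of_eventuallyEq (hrl τ hτ.1).symm))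
        (hf.intervalIntegrable _ _), conv_of_nonpos _ _ le_rfl, sub_zero]
  · intro h t ht
    refine HasDerivAt.congr_of_eventuallyEq (f := fun t => ∫ τ in (0 : ℝ)..t, f τ)
      (hf.integral_hasStrictDerivAt 0 t).hasDerivAt ?_
    filter_upwards [hrl t ht, Ioi_mem_nhds ht] with τ hτ hτ'
    rw [hτ, h, integral_eq_conv f (le_of_lt hτ')]

lemma log_exp_of_abs_im {w : ℂ} (hw : |w.im| < Real.pi / 2) : Complex.log (Complex.exp w) = w :=
  Complex.log_exp (by linarith [(abs_lt.1 hw).1, Real.pi_pos])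
    (by linarith [(abs_lt.1 hw).2, Real.pi_pos])

lemma lap_add_const_mul {f g : ℝ → ℂ} {s : ℂ}
    (hf : Integrable fun t : ℝ => Complex.exp (-s * t) * f t)
    (hg : Integrable fun t : ℝ => Complex.exp (-s * t) * g t) (c : ℂ) :
    lap (fun t => f t + c * g t) s = lap f s + c * lap g s := by
  simp only [lap]
  rw [← integral_const_mul, ← integral_add hf (hg.const_mul c)]
  congr 1; ext t; ring

/-- For bounded continuous functions the Caputo equation is equivalent to an equation between
Laplace transforms. -/
lemma lap_conv_rlKernel_sub {α : ℝ} (h1 : α < 1) {X f : ℝ → ℂ} (hX : Continuous X)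
    (hf : Continuous f) {C D : ℝ} (hC : ∀ t, ‖X t‖ ≤ C) (hD : ∀ t, ‖f t‖ ≤ D) {w : ℂ}
    (hw : |w.im| < Real.pi / 2) :
    lap (fun t => conv (causal (rlKernel (1 - α))) (causal fun τ => X τ - X 0) t +
        (-1) * conv (causal fun _ => 1) (causal f) t) (Complex.exp w) =
      (Complex.exp (α * w) * (lap (causal X) (Complex.exp w) - X 0 / Complex.exp w) -
        lap (causal f) (Complex.exp w)) / Complex.exp w := by
  have hs := exp_re_pos hw
  have i1 := integrable_exp_mul_rlKernel (β := 1 - α) (by linarith) hs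
  have i2 : Integrable fun t : ℝ => Complex.exp (-Complex.exp w * t) *
      causal (fun τ => X τ - X 0) t :=
    integrable_exp_mul_causal hs (by have := hX.measurable; fun_prop) (C := C + C)
      fun t => (norm_sub_le _ _).trans (add_le_add (hC _) (hC _))
  have i3 : Integrable fun t : ℝ => Complex.exp (-Complex.exp w * t) * causal (fun _ => 1) t :=
    integrable_exp_mul_causal hs measurable_const (C := 1) (by simp)
  have i4 : Integrable fun t : ℝ => Complex.exp (-Complex.exp w * t) * causal f t :=
    integrable_exp_mul_causal hs hf.measurable hD
  have i5 : Integrable fun t : ℝ => Complex.exp (-Complex.exp w * t) * causal X t :=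
    integrable_exp_mul_causal hs hX.measurable hC
  have i6 : Integrable fun t : ℝ => Complex.exp (-Complex.exp w * t) * causal (fun _ => X 0) t :=
    integrable_exp_mul_causal hs measurable_const (C := C) fun _ => hC 0
  have e : causal (fun τ => X τ - X 0) = fun t => causal X t + (-1) * causal (fun _ => X 0) t := by
    ext t; rw [causal_sub]; ring
  rw [lap_add_const_mul (integrable_exp_mul_conv i1 i2) (integrable_exp_mul_conv i3 i4),
    lap_conv i1 i2, lap_conv i3 i4, lap_rlKernel (by linarith) hs, log_exp_of_abs_im hw,
    lap_const_causal hs, e, lap_add_const_mul i5 i6, lap_const_causal hs]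
  have e2 : Complex.exp (-((1 - α : ℝ) : ℂ) * w) = Complex.exp (α * w) / Complex.exp w := by
    rw [← Complex.exp_sub]; push_cast; ring_nf
  rw [e2]
  ring

lemma lap_eq_of_hasCaputoDerivAt {α : ℝ} (h1 : α < 1) {X f : ℝ → ℂ} (hX : Continuous X)
    (hf : Continuous f) {C D : ℝ} (hC : ∀ t, ‖X t‖ ≤ C) (hD : ∀ t, ‖f t‖ ≤ D)
    (h : ∀ t > 0, HasCaputoDerivAt α 0 X (f t) t) {w : ℂ} (hw : |w.im| < Real.pi / 2) :
    Complex.exp (α * w) * (lap (causal X) (Complex.exp w) - X 0 / Complex.exp w) =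
      lap (causal f) (Complex.exp w) := by
  rw [hasCaputoDerivAt_iff_conv h1 hX hf hC] at h
  have h2 := lap_conv_rlKernel_sub h1 hX hf hC hD hw
  have h3 : lap (fun t => conv (causal (rlKernel (1 - α))) (causal fun τ => X τ - X 0) t +
        (-1) * conv (causal fun _ => 1) (causal f) t) (Complex.exp w) = 0 := by
    simp [h, lap]
  rw [h3, eq_comm, div_eq_zero_iff, or_iff_left (Complex.exp_ne_zero w)] at h2
  exact sub_eq_zero.1 h2

/-- Fourier inversion needs the identity on one vertical line only, so that line may be placed to
the right of the pole `μ`. -/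
lemma hasCaputoDerivAt_of_lap_eq {α : ℝ} (h1 : α < 1) {X f : ℝ → ℂ} (hX : Continuous X)
    (hf : Continuous f) {C D : ℝ} (hC : ∀ t, ‖X t‖ ≤ C) (hD : ∀ t, ‖f t‖ ≤ D) {σ : ℝ}
    (hσ : 0 < σ) (h : ∀ w : ℂ, |w.im| < Real.pi / 2 → (Complex.exp w).re = σ →
      Complex.exp (α * w) * (lap (causal X) (Complex.exp w) - X 0 / Complex.exp w) =
        lap (causal f) (Complex.exp w)) :
    ∀ t > 0, HasCaputoDerivAt α 0 X (f t) t := by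
  rw [hasCaputoDerivAt_iff_conv h1 hX hf hC]
  have hC2 : ∀ t, ‖X t - X 0‖ ≤ C + C :=
    fun t => (norm_sub_le _ _).trans (add_le_add (hC _) (hC _))
  have hσ' : 0 < (σ : ℂ).re := by simpa using hσ
  have i1 := integrable_exp_mul_rlKernel (β := 1 - α) (by linarith) hσ'
  have i2 := integrable_exp_mul_causal hσ' (f := fun τ => X τ - X 0)
    (by have := hX.measurable; fun_prop) hC2
  have i3 := integrable_exp_mul_causal hσ' (f := fun _ => (1 : ℂ)) measurable_const (C := 1)
    (by simp)
  have i4 := integrable_exp_mul_causal hσ' hf.measurable hD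
  ext t
  rw [← sub_eq_zero, sub_eq_add_neg, neg_eq_neg_one_mul]
  refine eq_zero_of_lap_eq_zero (σ := σ) (f := fun t =>
    conv (causal (rlKernel (1 - α))) (causal fun τ => X τ - X 0) t +
        (-1) * conv (causal fun _ => 1) (causal f) t) ?_ ?_ ?_
  · refine ((integrable_exp_mul_conv i1 i2).add
      ((integrable_exp_mul_conv i3 i4).const_mul (-1))).congr (ae_of_all _ fun t => ?_)
    simp only [Pi.add_apply]
    ring
  · intro s hs
    have hs0 : 0 < s.re := by rw [hs]; exact hσ
    have hs1 : s ≠ 0 := fun h => by simp [h] at hs0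
    have hw : |(Complex.log s).im| < Real.pi / 2 := by
      rw [Complex.log_im]
      exact Complex.abs_arg_lt_pi_div_two_iff.2 (Or.inl hs0)
    have h2 := lap_conv_rlKernel_sub h1 hX hf hC hD hw
    rw [h _ hw (by rw [Complex.exp_log hs1, hs]), sub_self, zero_div, Complex.exp_log hs1] at h2
    exact h2
  · refine Continuous.continuousAt ?_
    have c1 := continuous_conv_rlKernel (β := 1 - α) (by linarith)
      (hX.sub continuous_const) hC2
    have c2 : Continuous (conv (causal fun _ => 1) (causal f)) :=
      continuous_conv_causal (integrable_exp_mul_causal (by simp) measurable_const (C := 1)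
        (by simp)) hf hD
    fun_prop

/-- A bounded solution of the homogeneous scalar equation vanishes. -/
lemma eq_zero_of_hasCaputoDerivAt {α : ℝ} (h0 : 0 < α) (h1 : α < 1) {w₁ : ℂ}
    (hw₁ : |w₁.im| < Real.pi / 2) {X : ℝ → ℂ} (hX : Continuous X) {C : ℝ} (hC : ∀ t, ‖X t‖ ≤ C)
    (h : ∀ t > 0, HasCaputoDerivAt α 0 X (Complex.exp (α * w₁) * X t) t) {t : ℝ} (ht : 0 ≤ t) :
    X t = 0 := by
  have hL : ∀ w : ℂ, |w.im| < Real.pi / 2 →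
      Complex.exp (α * w) * (lap (causal X) (Complex.exp w) - X 0 / Complex.exp w) =
        Complex.exp (α * w₁) * lap (causal X) (Complex.exp w) := by
    intro w hw
    rw [lap_eq_of_hasCaputoDerivAt h1 hX (hX.const_mul _) hC
      (D := ‖Complex.exp (α * w₁)‖ * C) (fun t => ?_) h hw]
    · simp only [lap]
      rw [← integral_const_mul]
      congr 1; ext t; rw [causal_const_mul]; ring
    · rw [norm_mul]; gcongr; exact hC t
  -- At `w = w₁` the two transform terms cancel and only a nonzero multiple of `X 0` is left.
  have hX0 : X 0 = 0 := by
    have h2 := hL w₁ hw₁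
    have h3 := Complex.exp_ne_zero w₁
    have h4 := Complex.exp_ne_zero (α * w₁)
    have h5 := mul_left_cancel₀ h4 h2
    field_simp at h5
    simpa using h5
  rcases ht.eq_or_lt with rfl | ht
  · exact hX0
  rw [← causal_of_pos X ht]
  have hpos : 0 < (Complex.exp w₁).re := exp_re_pos hw₁
  -- This line misses `μ`, so `s ^ α - λ` can be cancelled along it.
  refine eq_zero_of_lap_eq_zero (σ := (Complex.exp w₁).re + 1)
    (integrable_exp_mul_causal (by simp; linarith) hX.measurable hC) ?_
    (continuousAt_causal hX ht.ne')
  intro s hs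
  have hs0 : 0 < s.re := by rw [hs]; linarith
  have hs1 : s ≠ 0 := fun h => by simp [h] at hs0
  have hw : |(Complex.log s).im| < Real.pi / 2 := by
    rw [Complex.log_im]
    exact Complex.abs_arg_lt_pi_div_two_iff.2 (Or.inl hs0)
  have h2 := hL _ hw
  rw [Complex.exp_log hs1, hX0, zero_div, sub_zero] at h2
  have h3 : Complex.exp (α * Complex.log s) - Complex.exp (α * w₁) ≠ 0 := by
    refine sub_ne_zero.2 fun h => ?_
    have h4 := exp_mul_injective_of_abs_im h0 h1 (by linarith [Real.pi_pos])
      (by linarith [Real.pi_pos]) h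
    rw [← h4, Complex.exp_log hs1] at hs
    linarith
  refine (mul_eq_zero.1 ?_).resolve_left h3
  rw [sub_mul, h2, sub_self]

/-! ### Construction of a bounded scalar solution. -/

lemma causal_eq_self {h : ℝ → ℂ} (h0 : ∀ t ≤ 0, h t = 0) : causal h = h := by
  ext t
  rcases le_or_gt t 0 with ht | ht
  · rw [causal_of_nonpos _ ht, h0 t ht]
  · rw [causal_of_pos _ ht]

lemma lap_zero_exp_causal {f : ℝ → ℂ} (s : ℂ) :
    ∫ τ, causal (fun t : ℝ => Complex.exp (-s * t)) τ * f τ = lap (causal f) s := by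
  rw [lap]
  congr 1; ext τ
  rcases le_or_gt τ 0 with ht | ht
  · simp [causal_of_nonpos, ht]
  · simp [causal_of_pos, ht]

/-- The reflected kernel `exp (s t)` on `(-∞, 0)`. -/
def anticausalExp (s : ℂ) (t : ℝ) : ℂ := causal (fun t : ℝ => Complex.exp (-s * t)) (-t)

lemma integrable_anticausalExp {s : ℂ} (hs : 0 < s.re) : Integrable (anticausalExp s) := by
  have h1 := integrable_exp_mul_exp_causal (s := 0) (a := -s) (by simpa using hs)
  simp only [neg_zero, zero_mul, Complex.exp_zero, one_mul] at h1
  exact h1.comp_neg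

lemma integral_anticausalExp {s : ℂ} (hs : 0 < s.re) : ∫ t, anticausalExp s t = 1 / s := by
  have h1 := lap_const_causal hs 1
  rw [← lap_zero_exp_causal] at h1
  simp only [mul_one] at h1
  rw [← h1]
  exact integral_neg_eq_self _ _

/-- Used to find the initial value of the constructed solution: for a forcing whose transform
vanishes at `s`, this convolution contributes nothing at time `0`. -/
lemma conv_anticausalExp_zero (s : ℂ) (f : ℝ → ℂ) :
    conv (anticausalExp s) f 0 = lap (causal f) s := by
  rw [← lap_zero_exp_causal, ← integral_neg_eq_self, conv]
  simp only [anticausalExp, zero_sub]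

lemma conv_eq_integral_sub (k f : ℝ → ℂ) (t : ℝ) : conv k f t = ∫ τ, k (t - τ) * f τ := by
  rw [conv, ← integral_sub_left_eq_self (fun τ => k τ * f (t - τ)) volume t]
  simp

/-- If the Laplace transform of `f` vanishes at `s`, then the growing exponential convolution
coincides up to sign with the bounded one. -/
lemma conv_exp_causal_eq_neg {s : ℂ} (hs : 0 < s.re) {f : ℝ → ℂ} (hf : Measurable f) {C : ℝ}
    (hC : ∀ t, ‖f t‖ ≤ C) (h0 : lap (causal f) s = 0) {t : ℝ} (ht : 0 < t) :
    conv (causal fun t => Complex.exp (s * t)) (causal f) t = - conv (anticausalExp s) f t := by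
  have i1 : Integrable fun τ => anticausalExp s (t - τ) * f τ :=
    ((integrable_anticausalExp hs).comp_sub_left t).mul_bdd (c := C) hf.aestronglyMeasurable
      (ae_of_all _ hC)
  have i2 := (integrable_exp_mul_causal hs hf hC).const_mul (Complex.exp (s * t))
  -- The integral over `(0, t)` is written as the integral over `(0, ∞)` minus the tail over `(t,
  -- ∞)`; the former is `exp(st)` times the vanishing transform.
  have h1 : conv (causal fun t => Complex.exp (s * t)) (causal f) t = ∫ τ : ℝ,
      (Complex.exp (s * t) * (Complex.exp (-s * τ) * causal f τ) - anticausalExp s (t - τ) * f τ) := by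
    rw [conv_eq_integral_sub]
    have : ∀ᵐ τ : ℝ, τ ≠ t := by simp [ae_iff]
    refine integral_congr_ae ?_
    filter_upwards [this] with τ hτ
    rcases le_or_gt τ 0 with h | h
    · simp [anticausalExp, causal_of_nonpos, h,
        show τ ≤ t by linarith]
    · rcases lt_or_gt_of_ne hτ with h2 | h2
      · rw [anticausalExp, causal_of_nonpos _ (show -(t - τ) ≤ 0 by linarith),
          causal_of_pos _ (show 0 < t - τ by linarith), zero_mul, sub_zero, ← mul_assoc,
          ← Complex.exp_add]
        push_cast; ring_nf
      · rw [anticausalExp, causal_of_pos _ (show 0 < -(t - τ) by linarith),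
          causal_of_nonpos _ (show t - τ ≤ 0 by linarith), causal_of_pos f h, zero_mul,
          ← mul_assoc, ← Complex.exp_add]
        push_cast; ring_nf
  have h2 : ∫ τ : ℝ, Complex.exp (-s * τ) * causal f τ = 0 := h0
  rw [h1, integral_sub i2 i1, integral_const_mul, h2, ← conv_eq_integral_sub]
  ring

/-- A bounded continuous right-hand side admits a bounded solution of the scalar equation, which
tends to zero if the right-hand side does. -/
lemma exists_bounded_solution {α : ℝ} (h0 : 0 < α) (h1 : α < 1) {w₁ : ℂ}
    (hw₁ : |w₁.im| < Real.pi / 2) {G : ℝ → ℂ} (hG : Continuous G) {C : ℝ} (hC : ∀ t, ‖G t‖ ≤ C) :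
    ∃ X : ℝ → ℂ, Continuous X ∧ (∃ D, ∀ t, ‖X t‖ ≤ D) ∧
      (∀ t > 0, HasCaputoDerivAt α 0 (fun s => X (s.toNNReal : ℝ))
        (Complex.exp (α * w₁) * X t + G t) t) ∧
      (Tendsto G atTop (𝓝 0) → Tendsto X atTop (𝓝 0)) := by
  have hpi := Real.pi_pos
  obtain ⟨h, hh, hh0, hl⟩ := exists_stable_kernel h0 h1 hw₁
  have hint := integral_stable_kernel h0 hh hh0 hl
  have hα : (α : ℂ) ≠ 0 := by exact_mod_cast h0.ne'
  have hlam := Complex.exp_ne_zero (α * w₁)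
  have hmu := Complex.exp_ne_zero w₁
  have hmure : 0 < (Complex.exp w₁).re := exp_re_pos hw₁
  -- The limit of the solution when the shifted forcing tends to `-γ`; the value of `∫ h` makes it
  -- zero.
  have hlim0 : ∀ γ : ℂ, -γ / Complex.exp (α * w₁) + (∫ t, h t) * (-γ) -
      Complex.exp w₁ / (α * Complex.exp (α * w₁)) * ((1 / Complex.exp w₁) * (-γ)) = 0 := by
    intro γ
    rw [hint]
    field_simp
    ring
  set lam := Complex.exp (α * w₁) with hlamd
  set μ := Complex.exp w₁ with hμ
  set c := μ / (α * lam) with hc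
  -- A constant `γ` has transform `γ/μ` at `μ`, so subtracting this one makes the transform of `f`
  -- vanish there.
  set γ := μ * lap (causal G) μ with hγ
  set f : ℝ → ℂ := fun t => G t - γ with hf
  have hfc : Continuous f := hG.sub continuous_const
  have hfC : ∀ t, ‖f t‖ ≤ C + ‖γ‖ := fun t => (norm_sub_le _ _).trans (by gcongr; exact hC t)
  have hlapf : ∀ s : ℂ, 0 < s.re → lap (causal f) s = lap (causal G) s - γ / s := by
    intro s hs
    have e : causal f = fun t => causal G t + (-1) * causal (fun _ => γ) t := by
      ext t; rw [hf, causal_sub]; ring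
    rw [e, lap_add_const_mul (integrable_exp_mul_causal hs hG.measurable hC)
      (integrable_exp_mul_causal hs measurable_const (C := ‖γ‖) fun _ => le_rfl),
      lap_const_causal hs]
    ring
  have hfμ : lap (causal f) μ = 0 := by
    rw [hlapf μ hmure, hγ]; field_simp; ring
  have hcf0 : 0 ≤ C + ‖γ‖ := (norm_nonneg _).trans (hfC 0)
  have hcfm := measurable_causal hfc.measurable
  have hcfC := norm_causal_le hcf0 hfC
  have hanti := integrable_anticausalExp hmure
  -- The anticausal form makes boundedness and the limit at infinity visible; for `t > 0` it is
  -- exchanged for the causal form to compute the transform.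
  set X : ℝ → ℂ := fun t => -γ / lam + conv h (causal f) t - c * conv (anticausalExp μ) f t with hX
  have hc1 : Continuous (conv h (causal f)) :=
    continuous_conv hh hcfm hcfC fun t ht => continuousAt_causal hfc ht
  have hc2 : Continuous (conv (anticausalExp μ) f) :=
    continuous_conv hanti hfc.measurable hfC fun t _ => hfc.continuousAt
  have hXc : Continuous X := by fun_prop
  obtain ⟨D, hD⟩ : ∃ D, ∀ t, ‖X t‖ ≤ D := by
    refine ⟨‖-γ / lam‖ + (∫ τ, ‖h τ‖) * (C + ‖γ‖) +
      ‖c‖ * ((∫ τ, ‖anticausalExp μ τ‖) * (C + ‖γ‖)), fun t => ?_⟩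
    refine (norm_sub_le _ _).trans (add_le_add ((norm_add_le _ _).trans ?_) ?_)
    · gcongr; exact norm_conv_le hh hcfC t
    · rw [norm_mul]; gcongr; exact norm_conv_le hanti hfC t
  refine ⟨X, hXc, ⟨D, hD⟩, ?_, ?_⟩
  · have hX0 : X 0 = -γ / lam := by
      have e1 : conv h (causal f) 0 = 0 := by
        rw [← causal_eq_self hh0]; exact conv_of_nonpos _ _ le_rfl
      rw [hX]
      simp only [e1, conv_anticausalExp_zero, hfμ]
      ring
    set Xe : ℝ → ℂ := fun s => X (s.toNNReal : ℝ) with hXe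
    have hXec : Continuous Xe := hXc.comp (by fun_prop)
    have hXe0 : Xe 0 = -γ / lam := by simp [hXe, hX0]
    have hXeC : ∀ t, ‖Xe t‖ ≤ D := fun t => hD _
    have hpos : ∀ t > 0, Xe t = X t := fun t ht => by
      simp only [hXe]; rw [Real.coe_toNNReal _ (le_of_lt ht)]
    have key : ∀ t > 0, HasCaputoDerivAt α 0 Xe ((fun t => lam * Xe t + G t) t) t := by
      -- The transform of `exp(μt)` converges only for `Re s > Re μ`, hence the choice of `σ`.
      refine hasCaputoDerivAt_of_lap_eq h1 hXec (by fun_prop) (D := ‖lam‖ * D + C) hXeC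
        (fun t => ?_) (σ := μ.re + 1) (by linarith) ?_
      · refine (norm_add_le _ _).trans (add_le_add ?_ (hC t))
        rw [norm_mul]; gcongr; exact hXeC t
      · intro w hw hre
        have hs : 0 < (Complex.exp w).re := exp_re_pos hw
        have hne : w ≠ w₁ := by
          rintro rfl
          rw [← hμ] at hre; linarith
        have hμs : μ.re < (Complex.exp w).re := by rw [hre]; linarith
        have j1 := integrable_exp_mul_of_causal hh hh0 hs.le
        have j2 := integrable_exp_mul_causal hs hfc.measurable hfC
        have j3 := integrable_exp_mul_exp_causal hμs
        have j4 := integrable_exp_mul_causal hs (f := fun _ => -γ / lam) measurable_const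
          (C := ‖-γ / lam‖) fun _ => le_rfl
        have j5 : Integrable fun t : ℝ => Complex.exp (-Complex.exp w * t) * causal Xe t :=
          integrable_exp_mul_causal hs hXec.measurable hXeC
        have j6 : Integrable fun t : ℝ => Complex.exp (-Complex.exp w * t) * causal G t :=
          integrable_exp_mul_causal hs hG.measurable hC
        have e : causal Xe = fun t => (causal (fun _ => -γ / lam) t + 1 * conv h (causal f) t) +
            c * conv (causal fun t => Complex.exp (μ * t)) (causal f) t := by
          ext t
          rcases le_or_gt t 0 with ht | ht
          · rw [causal_of_nonpos _ ht, causal_of_nonpos _ ht, conv_of_nonpos _ _ ht,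
              ← causal_eq_self hh0, conv_of_nonpos _ _ ht]
            ring
          · rw [causal_of_pos _ ht, causal_of_pos _ ht, hpos t ht,
              conv_exp_causal_eq_neg hmure hfc.measurable hfC hfμ ht, hX]
            ring
        have j7 : Integrable fun t : ℝ => Complex.exp (-Complex.exp w * t) *
            (causal (fun _ => -γ / lam) t + 1 * conv h (causal f) t) := by
          refine (j4.add (integrable_exp_mul_conv j1 j2)).congr (ae_of_all _ fun t => ?_)
          simp only [Pi.add_apply]; ring
        have e2 : lap (causal Xe) (Complex.exp w) = -γ / lam / Complex.exp w +
            lap (causal f) (Complex.exp w) / (Complex.exp (α * w) - lam) := by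
          rw [e, lap_add_const_mul j7 (integrable_exp_mul_conv j3 j2),
            lap_add_const_mul j4 (integrable_exp_mul_conv j1 j2), lap_conv j1 j2, lap_conv j3 j2,
            lap_const_causal hs, lap_exp_causal hμs, hl w hw hne]
          ring
        have e3 : (causal fun t => lam * Xe t + G t) = fun t => causal G t + lam * causal Xe t := by
          ext t; rw [causal_add, causal_const_mul]; ring
        have hden : Complex.exp (α * w) - lam ≠ 0 := sub_ne_zero.2 fun h' =>
          hne (exp_mul_injective_of_abs_im h0 h1 (by linarith) (by linarith) h')
        have e4 : lap (causal G) (Complex.exp w) =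
            lap (causal f) (Complex.exp w) + γ / Complex.exp w := by
          rw [hlapf _ hs]; ring
        rw [e3, lap_add_const_mul j6 j5, e2, hXe0, e4]
        have hse := Complex.exp_ne_zero w
        field_simp
        ring
    intro t ht
    rw [← hpos t ht]
    exact key t ht
  · intro hG0
    have hft : Tendsto f atTop (𝓝 (-γ)) := by
      simpa using hG0.sub_const γ
    have hcft : Tendsto (causal f) atTop (𝓝 (-γ)) := by
      refine hft.congr' ?_
      filter_upwards [eventually_gt_atTop 0] with t ht using (causal_of_pos f ht).symm
    have t1 := tendsto_conv hh hcfm hcfC hcft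
    have t2 := tendsto_conv hanti hfc.measurable hfC hft
    rw [integral_anticausalExp hmure] at t2
    have t3 := (t1.const_add (-γ / lam)).sub (t2.const_mul c)
    rw [hlim0 γ] at t3
    exact t3

/-! ### Scalar equations on the half line. -/

lemma rlIntegral_sub {β : ℝ} (hβ : 0 < β) {f g : ℝ → ℂ} (hf : Continuous f) (hg : Continuous g)
    (t : ℝ) : rlIntegral β 0 (fun τ => f τ - g τ) t = rlIntegral β 0 f t - rlIntegral β 0 g t := by
  have hk : IntervalIntegrable (fun τ : ℝ => (((t - τ) ^ (β - 1) : ℝ) : ℂ)) volume 0 t := by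
    have h1 := (intervalIntegral.intervalIntegrable_rpow' (a := t) (b := 0) (r := β - 1)
      (by linarith)).comp_sub_left t
    simp only [sub_self, sub_zero] at h1
    exact ⟨h1.1.ofReal, h1.2.ofReal⟩
  simp only [rlIntegral, mul_sub]
  rw [intervalIntegral.integral_sub (hk.mul_continuousOn hf.continuousOn)
    (hk.mul_continuousOn hg.continuousOn), mul_sub]

lemma HasCaputoDerivAt.sub {α : ℝ} (h1 : α < 1) {f g : ℝ → ℂ} (hf : Continuous f)
    (hg : Continuous g) {v w : ℂ} {t : ℝ} (hv : HasCaputoDerivAt α 0 f v t)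
    (hw : HasCaputoDerivAt α 0 g w t) : HasCaputoDerivAt α 0 (fun s => f s - g s) (v - w) t := by
  have h2 := HasDerivAt.sub hv hw
  refine h2.congr_of_eventuallyEq (Eventually.of_forall fun t => ?_)
  have h3 := rlIntegral_sub (β := 1 - α) (by linarith) (f := fun τ => f τ - f 0)
    (g := fun τ => g τ - g 0) (hf.sub continuous_const) (hg.sub continuous_const) t
  rw [Pi.sub_apply, ← h3]
  congr 1; ext τ; ring

/-- `x` solves the scalar equation `D^α x = z x + g` on `[0, ∞)`. -/
def IsScalarSolution (α : ℝ) (z : ℂ) (g x : ℝ≥0 →ᵇ ℂ) : Prop :=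
  ∀ t : ℝ≥0, 0 < t →
    HasCaputoDerivAt α 0 (fun s : ℝ => x s.toNNReal) (z * x t + g t) (t : ℝ)

/-- Dividing the principal logarithm by `α` turns the sector `|arg z| < απ/2` into the strip `|Im w|
< π/2`, that is, `Re μ > 0`. -/
lemma exists_exp_mul_eq {α : ℝ} (h0 : 0 < α) {z : ℂ} (hz : z ∈ unstableSector α) :
    ∃ w : ℂ, |w.im| < Real.pi / 2 ∧ Complex.exp (α * w) = z := by
  have hα : (α : ℂ) ≠ 0 := by exact_mod_cast h0.ne'
  refine ⟨Complex.log z / α, ?_, ?_⟩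
  · rw [Complex.div_ofReal_im, Complex.log_im, abs_div, abs_of_pos h0, div_lt_iff₀ h0]
    linarith [hz.2]
  · rw [mul_div_cancel₀ _ hα, Complex.exp_log hz.1]

lemma IsScalarSolution.unique {α : ℝ} (h0 : 0 < α) (h1 : α < 1) {z : ℂ}
    (hz : z ∈ unstableSector α) {g x y : ℝ≥0 →ᵇ ℂ} (hx : IsScalarSolution α z g x)
    (hy : IsScalarSolution α z g y) : x = y := by
  obtain ⟨w, hw, rfl⟩ := exists_exp_mul_eq h0 hz
  ext t
  rw [← sub_eq_zero]
  have hcx : Continuous fun s : ℝ => x s.toNNReal := by fun_prop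
  have hcy : Continuous fun s : ℝ => y s.toNNReal := by fun_prop
  have h2 := eq_zero_of_hasCaputoDerivAt h0 h1 hw (X := fun s => x s.toNNReal - y s.toNNReal)
    (hcx.sub hcy) (C := ‖x - y‖) (fun s => (x - y).norm_coe_le_norm _) ?_ t.coe_nonneg
  · simpa using h2
  · intro s hs
    have h3 := HasCaputoDerivAt.sub h1 hcx hcy (hx s.toNNReal (by simpa using hs))
      (hy s.toNNReal (by simpa using hs))
    rw [Real.coe_toNNReal _ hs.le] at h3
    convert h3 using 1
    ring

lemma exists_isScalarSolution {α : ℝ} (h0 : 0 < α) (h1 : α < 1) {z : ℂ}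
    (hz : z ∈ unstableSector α) (g : ℝ≥0 →ᵇ ℂ) :
    ∃ x : ℝ≥0 →ᵇ ℂ, IsScalarSolution α z g x ∧
      (Tendsto g atTop (𝓝 0) → Tendsto x atTop (𝓝 0)) := by
  obtain ⟨w, hw, rfl⟩ := exists_exp_mul_eq h0 hz
  obtain ⟨X, hX, ⟨D, hD⟩, heq, hlim⟩ := exists_bounded_solution h0 h1 hw
    (G := fun s => g s.toNNReal) (by fun_prop) (C := ‖g‖) (fun s => g.norm_coe_le_norm _)
  refine ⟨BoundedContinuousFunction.ofNormedAddCommGroup (fun t : ℝ≥0 => X t) (by fun_prop) D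
    fun t => hD _, fun t ht => ?_, fun hg => ?_⟩
  · have := heq t (by exact_mod_cast ht)
    simpa using this
  · exact (hlim (hg.comp tendsto_real_toNNReal_atTop)).comp (NNReal.tendsto_coe_atTop.2 tendsto_id)

lemma IsScalarSolution.tendsto_zero {α : ℝ} (h0 : 0 < α) (h1 : α < 1) {z : ℂ}
    (hz : z ∈ unstableSector α) {g x : ℝ≥0 →ᵇ ℂ} (hx : IsScalarSolution α z g x)
    (hg : Tendsto g atTop (𝓝 0)) : Tendsto x atTop (𝓝 0) := by
  obtain ⟨y, hy, hlim⟩ := exists_isScalarSolution h0 h1 hz g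
  rw [hx.unique h0 h1 hz hy]
  exact hlim hg

/-! ### Reduction of a Jordan block to scalar equations. -/

/-- The entry following the `i`-th one, zero for the last `i`. -/
def nextEntry {β : Type*} [Zero β] {d : ℕ} (v : Fin d → β) (i : Fin d) : β :=
  if h : (i : ℕ) + 1 < d then v ⟨i + 1, h⟩ else 0

lemma jordanBlock_mulVec {d : ℕ} (z : ℂ) (v : Fin d → ℂ) (i : Fin d) :
    (jordanBlock d z).mulVec v i = z * v i + nextEntry v i := by
  have e : ∀ j : Fin d, jordanBlock d z i j * v j =
      (if i = j then z * v j else 0) + (if (i : ℕ) + 1 = (j : ℕ) then v j else 0) := by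
    intro j
    simp only [jordanBlock, Matrix.of_apply]
    by_cases h : i = j
    · subst h; simp
    · by_cases h2 : (i : ℕ) + 1 = (j : ℕ) <;> simp [h, h2]
  simp only [Matrix.mulVec, dotProduct, e, Finset.sum_add_distrib, Finset.sum_ite_eq,
    Finset.mem_univ, if_true]
  congr 1
  rw [nextEntry]
  split_ifs with h
  · rw [Finset.sum_eq_single ⟨i + 1, h⟩]
    · simp
    · intro j _ hj
      rw [if_neg]
      intro h'
      exact hj (Fin.ext h'.symm)
    · simp
  · refine Finset.sum_eq_zero fun j _ => if_neg fun h' => h ?_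
    rw [h']; exact j.isLt

/-- The components of a bounded continuous vector-valued function. -/
def component {d : ℕ} (x : ℝ≥0 →ᵇ (Fin d → ℂ)) (i : Fin d) : ℝ≥0 →ᵇ ℂ :=
  BoundedContinuousFunction.ofNormedAddCommGroup (fun t => x t i)
    ((continuous_apply i).comp x.continuous) ‖x‖
    fun t => (norm_le_pi_norm _ i).trans (x.norm_coe_le_norm t)

lemma nextEntry_apply {d : ℕ} (u : Fin d → (ℝ≥0 →ᵇ ℂ)) (i : Fin d) (t : ℝ≥0) :
    nextEntry u i t = nextEntry (fun j => u j t) i := by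
  unfold nextEntry
  split_ifs <;> simp

/-- Row `i` of the block involves only entries `i` and `i + 1`, so the next entry can be moved into
the forcing. -/
lemma isBoundedSolution_iff {d : ℕ} {α : ℝ} {z : ℂ} {g x : ℝ≥0 →ᵇ (Fin d → ℂ)} :
    IsBoundedSolution α (jordanBlock d z) g x ↔
      ∀ i, IsScalarSolution α z (component g i + nextEntry (component x) i) (component x i) := by
  have e : ∀ (t : ℝ≥0) (i : Fin d), ((jordanBlock d z).mulVec (x t) + g t) i =
      z * component x i t + (component g i + nextEntry (component x) i) t := by
    intro t i
    rw [Pi.add_apply, jordanBlock_mulVec, BoundedContinuousFunction.add_apply, nextEntry_apply]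
    simp only [component, BoundedContinuousFunction.coe_ofNormedAddCommGroup]
    ring
  constructor
  · rintro ⟨h, -⟩ i t ht
    rw [← e]
    exact h.hasCaputoDerivAt t ht i
  · intro h
    refine ⟨⟨x.continuous, fun t ht i => ?_⟩, x.isBounded_range⟩
    rw [e]
    exact h i t ht

lemma IsBoundedSolution.exists_eq_coe {d : ℕ} {α : ℝ} {A : Matrix (Fin d) (Fin d) ℂ}
    {g x : ℝ≥0 → Fin d → ℂ} (h : IsBoundedSolution α A g x) :
    ∃ y : ℝ≥0 →ᵇ (Fin d → ℂ), x = y := by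
  obtain ⟨C, hC⟩ := h.2.exists_norm_le
  exact ⟨BoundedContinuousFunction.ofNormedAddCommGroup x h.1.continuous C
    fun t => hC _ (Set.mem_range_self t), rfl⟩

/-- Downward induction along a Jordan block. -/
lemma nextEntry_induction {d : ℕ} {P : Fin d → Prop}
    (h : ∀ i : Fin d, (∀ h : (i : ℕ) + 1 < d, P ⟨i + 1, h⟩) → P i) (i : Fin d) : P i := by
  suffices H : ∀ k (i : Fin d), d - i = k → P i from H _ i rfl
  intro k
  induction k with
  | zero => intro i hi; have := i.isLt; omega
  | succ k ih => intro i hi; exact h i fun h' => ih _ (by simp only; omega)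

lemma exists_jordan_solution {d : ℕ} {α : ℝ} (h0 : 0 < α) (h1 : α < 1) {z : ℂ}
    (hz : z ∈ unstableSector α) (g : ℝ≥0 →ᵇ (Fin d → ℂ)) :
    ∃ u : Fin d → (ℝ≥0 →ᵇ ℂ), ∀ i, IsScalarSolution α z (component g i + nextEntry u i) (u i) := by
  choose S hS _ using exists_isScalarSolution h0 h1 hz
  let gg : ℕ → (ℝ≥0 →ᵇ ℂ) := fun k =>
    if h : d - (k + 1) < d then component g ⟨d - (k + 1), h⟩ else 0
  -- Indexed from the bottom: `u (k + 1)` solves row `d - (k + 1)`, and `u 0 = 0` stands for the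
  -- absent entry after the last row.
  let u : ℕ → (ℝ≥0 →ᵇ ℂ) := fun n => Nat.rec 0 (fun k v => S (gg k + v)) n
  have hu : ∀ k, u (k + 1) = S (gg k + u k) := fun _ => rfl
  refine ⟨fun i => u (d - i), fun i => ?_⟩
  have hi := i.isLt
  obtain ⟨k, hk⟩ : ∃ k, d - (i : ℕ) = k + 1 := ⟨d - i - 1, by omega⟩
  have hik : d - (k + 1) = i := by omega
  have e1 : gg k = component g i := by
    simp only [gg, hik, hi, dif_pos]
  have e2 : nextEntry (fun i : Fin d => u (d - i)) i = u k := by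
    rw [nextEntry]
    split_ifs with h
    · simp only
      congr 1; omega
    · have : k = 0 := by omega
      rw [this]; rfl
  rw [e2]
  simp only [hk, hu, e1]
  exact hS _

end CaputoJordan

end

open CaputoJordan in
theorem proposition4 (α : ℝ) (hα0 : 0 < α) (hα1 : α < 1) (d : ℕ) (z : ℂ)
    (hz : z ∈ CaputoJordan.unstableSector α) (g : ℝ≥0 →ᵇ (Fin d → ℂ)) :
    (∃! x : ℝ≥0 → Fin d → ℂ,
      CaputoJordan.IsBoundedSolution α (CaputoJordan.jordanBlock d z) g x) ∧
    (Filter.Tendsto g Filter.atTop (nhds 0) →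
      ∀ x : ℝ≥0 → Fin d → ℂ,
        CaputoJordan.IsBoundedSolution α (CaputoJordan.jordanBlock d z) g x →
        Filter.Tendsto x Filter.atTop (nhds 0)) := by
  refine ⟨?_, ?_⟩
  · obtain ⟨u, hu⟩ := exists_jordan_solution hα0 hα1 hz g
    let x : ℝ≥0 →ᵇ (Fin d → ℂ) := BoundedContinuousFunction.ofNormedAddCommGroup
      (fun t i => u i t) (continuous_pi fun i => (u i).continuous) ‖u‖ fun t =>
        (pi_norm_le_iff_of_nonneg (norm_nonneg _)).2 fun i =>
          ((u i).norm_coe_le_norm t).trans (norm_le_pi_norm u i)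
    have hcx : component x = u := rfl
    have hx : IsBoundedSolution α (jordanBlock d z) g x := by
      rw [isBoundedSolution_iff, hcx]
      exact hu
    refine ⟨x, hx, fun y hy => ?_⟩
    obtain ⟨y, rfl⟩ := hy.exists_eq_coe
    rw [isBoundedSolution_iff] at hx hy
    -- Once the later entries agree, both `i`-th components solve one and the same scalar equation.
    have key : ∀ i, component y i = component x i := by
      refine nextEntry_induction fun i hi => ?_
      have e : nextEntry (component y) i = nextEntry (component x) i := by
        unfold nextEntry
        split_ifs with h
        · exact hi h
        · rfl
      have := hy i
      rw [e] at this
      exact this.unique hα0 hα1 hz (hx i)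
    ext t i
    exact congrArg (fun v : ℝ≥0 →ᵇ ℂ => v t) (key i)
  · intro hg x hx
    obtain ⟨x, rfl⟩ := hx.exists_eq_coe
    rw [isBoundedSolution_iff] at hx
    rw [tendsto_pi_nhds] at hg ⊢
    suffices key : ∀ i, Filter.Tendsto (component x i) Filter.atTop (nhds 0) from fun i => key i
    -- Decay also climbs the block: the forcing of row `i` tends to zero because the next component
    -- does.
    refine nextEntry_induction fun i hi => (hx i).tendsto_zero hα0 hα1 hz ?_
    have h1 : Filter.Tendsto (component g i) Filter.atTop (nhds 0) := hg i
    have h2 : Filter.Tendsto (⇑(nextEntry (component x) i : ℝ≥0 →ᵇ ℂ)) Filter.atTop (nhds 0) := by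
      unfold nextEntry
      split_ifs with h
      · exact hi h
      · exact tendsto_const_nhds
    simpa [Pi.add_def] using h1.add h2
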